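/- Let $b\ge 2$ be an integer. Radix Selection with $b$ buckets selects the datum of rank $\ell$ (the $\ell$-th smallest) among $n$ data in $[0,1]$ as follows. The current bucket is initially $[0,1]$. As long as the current bucket contains at least two data, it is decomposed into $b$ buckets of equal length (half-open on the right, except that the right endpoint $1$ belongs to the last bucket), each of its data is assigned to one of these buckets at the cost of one bucket operation per datum, and the bucket that contains the datum of rank $\ell$ becomes the current bucket. The algorithm stops once the current bucket contains no datum other than the one to be selected. For $1\le \ell\le n$ let $Y_n(\ell)$ be the total number of bucket operations when the data are $n$ independent random variables, uniformly distributed on $[0,1]$; set $Y_n(n+1):=Y_n(n)$. For $n\ge 1$ and $t\in[0,1]$ let $$X_n(t):=\frac{Y_n(\lfloor tn\rfloor+1)-\frac{b}{b-1}n}{\sqrt n}.$$ For $s,t\in[0,1]$ let $s=\sum_{i\ge1}s_ib^{-i}$ and $t=\sum_{i\ge1}t_ib^{-i}$ be their $b$-ary expansions with digits in $\{0,\dots,b-1\}$, where for a number in $[0,1)$ the expansion with infinitely many digits different from $b-1$ is taken, and for the number $1$ the one with all digits equal to $b-1$. Let $$j(s,t):=\sup\{k\ge 0: (s_1,\dots,s_k)=(t_1,\dots,t_k)\}\in\{0,1,2,\dots\}\cup\{\infty\}.$$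 Then there is a centered Gaussian process $G=(G(t))_{t\in[0,1]}$ with càdlàg paths, depending only on $b$, with covariance function $$\mathbb E[G(s)G(t)]=\frac{b}{(b-1)^2}-\frac{b+1}{(b-1)^2}\,b^{-j(s,t)},\qquad s,t\in[0,1],\qquad b^{-\infty}:=0,$$ such that, as $n\to\infty$, the processes $X_n=(X_n(t))_{t\in[0,1]}$ converge in distribution to $G$ in the space $D[0,1]$ of càdlàg functions on $[0,1]$, endowed with the Skorokhod metric $$d(x,y)=\inf_{\lambda}\max\Big\{\sup_{t\in[0,1]}|\lambda(t)-t|,\ \sup_{t\in[0,1]}|x(t)-y(\lambda(t))|\Big\},$$ where $\lambda$ ranges over the increasing bijections of $[0,1]$. -/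

import Mathlib

open MeasureTheory ProbabilityTheory Filter Topology
open scoped unitInterval

noncomputable section

namespace RadixSelection

/-! ### The space `D[0,1]` with the Skorokhod metric -/

/-- The space `D[0,1]` of càdlàg functions `[0,1] → ℝ`: right-continuous with left limits.
(At `t = 1` the first condition and at `t = 0` the second one are void.) -/
@[ext]
structure Cadlag where
  toFun : I → ℝ
  right_cont : ∀ t, ContinuousWithinAt toFun (Set.Ici t) t
  left_lim : ∀ t, ∃ l, Tendsto toFun (𝓝[<] t) (𝓝 l)

instance : CoeFun Cadlag (fun _ => I → ℝ) := ⟨Cadlag.toFun⟩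

/-- There is an increasing bijection `φ` of `[0,1]` onto itself such that
`sup |φ(t) - t| ≤ ε` and `sup |x(t) - y(φ(t))| ≤ ε`. -/
def SkorokhodClose (x y : Cadlag) (ε : ℝ) : Prop :=
  ∃ φ : I ≃o I, ∀ t, |(φ t : ℝ) - t| ≤ ε ∧ |x t - y (φ t)| ≤ ε

/-- The Skorokhod distance `d(x, y)`. -/
def skorokhodDist (x y : Cadlag) : ℝ := sInf {ε : ℝ | SkorokhodClose x y ε}

lemma SkorokhodClose.nonneg {x y : Cadlag} {ε : ℝ} (h : SkorokhodClose x y ε) : 0 ≤ ε := by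
  obtain ⟨φ, h⟩ := h
  exact (abs_nonneg _).trans (h 0).1

lemma SkorokhodClose.symm {x y : Cadlag} {ε : ℝ} (h : SkorokhodClose x y ε) :
    SkorokhodClose y x ε := by
  obtain ⟨φ, h⟩ := h
  refine ⟨φ.symm, fun t => ?_⟩
  have := h (φ.symm t)
  rw [OrderIso.apply_symm_apply] at this
  rw [abs_sub_comm, abs_sub_comm (y t)]
  exact this

lemma SkorokhodClose.trans {x y z : Cadlag} {ε δ : ℝ} (h : SkorokhodClose x y ε)
    (h' : SkorokhodClose y z δ) : SkorokhodClose x z (ε + δ) := by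
  obtain ⟨φ, h⟩ := h
  obtain ⟨ψ, h'⟩ := h'
  refine ⟨φ.trans ψ, fun t => ?_⟩
  have h1 := h t
  have h2 := h' (φ t)
  simp only [OrderIso.trans_apply]
  constructor
  · have := abs_sub_le (ψ (φ t) : ℝ) (φ t) t
    linarith [h1.1, h2.1]
  · have := abs_sub_le (x t) (y (φ t)) (z (ψ (φ t)))
    linarith [h1.2, h2.2]

lemma Cadlag.exists_bound (x : Cadlag) : ∃ C : ℝ, ∀ t, |x t| ≤ C := by
  have key : ∃ C : ℝ, ∀ t ∈ (Set.univ : Set I), |x t| ≤ C := by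
    refine isCompact_univ.induction_on (p := fun s => ∃ C : ℝ, ∀ t ∈ s, |x t| ≤ C) ?_ ?_ ?_ ?_
    · exact ⟨0, by simp⟩
    · rintro s u hsu ⟨C, hC⟩
      exact ⟨C, fun t ht => hC t (hsu ht)⟩
    · rintro s u ⟨C, hC⟩ ⟨C', hC'⟩
      refine ⟨max C C', fun t ht => ?_⟩
      rcases ht with ht | ht
      · exact (hC t ht).trans (le_max_left _ _)
      · exact (hC' t ht).trans (le_max_right _ _)
    · intro t _
      obtain ⟨l, hl⟩ := x.left_lim t
      have e1 : ∀ᶠ s in 𝓝[<] t, |x s| ≤ |l| + 1 :=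
        (hl.abs.eventually_lt_const (lt_add_one _)).mono fun _ h => h.le
      have e2 : ∀ᶠ s in 𝓝[≥] t, |x s| ≤ |x t| + 1 :=
        ((x.right_cont t).abs.eventually_lt_const (lt_add_one _)).mono fun _ h => h.le
      refine ⟨{s | |x s| ≤ max (|l| + 1) (|x t| + 1)}, ?_, _, fun s hs => hs⟩
      rw [nhdsWithin_univ, ← nhdsLT_sup_nhdsGE]
      exact ⟨e1.mono fun _ h => h.trans (le_max_left _ _),
        e2.mono fun _ h => h.trans (le_max_right _ _)⟩
  obtain ⟨C, hC⟩ := key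
  exact ⟨C, fun t => hC t trivial⟩

lemma exists_skorokhodClose (x y : Cadlag) : ∃ ε, SkorokhodClose x y ε := by
  obtain ⟨C, hC⟩ := x.exists_bound
  obtain ⟨C', hC'⟩ := y.exists_bound
  refine ⟨C + C', OrderIso.refl I, fun t => ⟨?_, ?_⟩⟩
  · simpa using add_nonneg ((abs_nonneg _).trans (hC 0)) ((abs_nonneg _).trans (hC' 0))
  · exact (abs_sub _ _).trans (add_le_add (hC _) (hC' _))

lemma bddBelow_skorokhodClose (x y : Cadlag) : BddBelow {ε : ℝ | SkorokhodClose x y ε} :=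
  ⟨0, fun _ h => SkorokhodClose.nonneg h⟩

lemma exists_skorokhodClose_lt {x y : Cadlag} {ε : ℝ} (h : skorokhodDist x y < ε) :
    ∃ δ < ε, SkorokhodClose x y δ := by
  obtain ⟨δ, hδ, hlt⟩ := exists_lt_of_csInf_lt (exists_skorokhodClose x y) h
  exact ⟨δ, hlt, hδ⟩

lemma eq_of_skorokhodDist_eq_zero {x y : Cadlag} (h : skorokhodDist x y = 0) : x = y := by
  have hclose : ∀ ε > 0, ∃ φ : I ≃o I, ∀ t, |(φ t : ℝ) - t| < ε ∧ |x t - y (φ t)| < ε := by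
    intro ε hε
    obtain ⟨δ, hδ, φ, hφ⟩ := exists_skorokhodClose_lt (h.trans_lt hε)
    exact ⟨φ, fun t => ⟨(hφ t).1.trans_lt hδ, (hφ t).2.trans_lt hδ⟩⟩
  ext t
  refine eq_of_abs_sub_le_all fun ε hε => ?_
  rcases eq_or_ne t 1 with rfl | ht
  · obtain ⟨φ, hφ⟩ := hclose ε hε
    have := (hφ 1).2
    have h1 : φ 1 = 1 := φ.map_top
    rw [h1] at this
    exact this.le
  · have ht1 : t < 1 := lt_of_le_of_ne unitInterval.le_one' ht
    have hx := Metric.continuousWithinAt_iff.1 (x.right_cont t) (ε / 3) (by positivity)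
    have hy := Metric.continuousWithinAt_iff.1 (y.right_cont t) (ε / 3) (by positivity)
    obtain ⟨δ, hδ, hx⟩ := hx
    obtain ⟨δ', hδ', hy⟩ := hy
    have ht1' : (t : ℝ) < 1 := ht1
    set r : ℝ := min (min (δ / 2) (δ' / 2)) (1 - t) with hr
    have hr0 : 0 < r := by
      simp only [hr, lt_min_iff]
      exact ⟨⟨by positivity, by positivity⟩, by linarith⟩
    have hr1 : r ≤ δ / 2 := (min_le_left _ _).trans (min_le_left _ _)
    have hr2 : r ≤ δ' / 2 := (min_le_left _ _).trans (min_le_right _ _)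
    have hr3 : r ≤ 1 - t := min_le_right _ _
    have ht0 : (0 : ℝ) ≤ t := t.2.1
    let s : I := ⟨t + r / 2, by constructor <;> linarith⟩
    have hs : (s : ℝ) = t + r / 2 := rfl
    obtain ⟨φ, hφ⟩ := hclose (min (ε / 3) (r / 2)) (by positivity)
    obtain ⟨h1, h2⟩ := hφ s
    have h1 := h1.trans_le (min_le_right _ _)
    have h2 := h2.trans_le (min_le_left _ _)
    rw [abs_lt] at h1
    have hxs : |x s - x t| < ε / 3 := by
      refine hx (x := s) (show (t : ℝ) ≤ s by rw [hs]; linarith) ?_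
      rw [Subtype.dist_eq, Real.dist_eq, hs, abs_lt]
      constructor <;> linarith
    have hys : |y (φ s) - y t| < ε / 3 := by
      refine hy (x := φ s) (show (t : ℝ) ≤ φ s by linarith) ?_
      rw [Subtype.dist_eq, Real.dist_eq, abs_lt]
      constructor <;> linarith
    rw [abs_lt] at hxs hys h2
    show |x t - y t| ≤ ε
    rw [abs_le]
    constructor <;> linarith

instance : MetricSpace Cadlag where
  dist := skorokhodDist
  dist_self x := by
    refine le_antisymm (csInf_le (bddBelow_skorokhodClose x x) ⟨OrderIso.refl I, by simp⟩) ?_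
    exact Real.sInf_nonneg fun _ h => SkorokhodClose.nonneg h
  dist_comm x y := by
    have : {ε : ℝ | SkorokhodClose x y ε} = {ε : ℝ | SkorokhodClose y x ε} :=
      Set.ext fun _ => ⟨fun h => h.symm, fun h => h.symm⟩
    simp only [skorokhodDist, this]
  dist_triangle x y z := by
    refine le_of_forall_pos_lt_add fun η hη => ?_
    obtain ⟨ε, hε, h⟩ := exists_skorokhodClose_lt
      (show skorokhodDist x y < skorokhodDist x y + η / 2 by linarith)
    obtain ⟨δ, hδ, h'⟩ := exists_skorokhodClose_lt
      (show skorokhodDist y z < skorokhodDist y z + η / 2 by linarith)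
    have := csInf_le (bddBelow_skorokhodClose x z) (h.trans h')
    change skorokhodDist x z ≤ _ at this
    linarith
  eq_of_dist_eq_zero := eq_of_skorokhodDist_eq_zero

instance : MeasurableSpace Cadlag := borel Cadlag

instance : BorelSpace Cadlag := ⟨rfl⟩

/-! ### The algorithm and its number of bucket operations -/

/-- The bucket `[lo, lo + w)` (or `[lo, lo + w]`) is decomposed into `b` buckets of length `w / b`,
numbered `0, …, b - 1`; this is the number of the one that contains `x`. It is the `r` with
`lo + r * w / b ≤ x < lo + (r + 1) * w / b`; the right endpoint of the last bucket belongs to the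
last bucket. -/
def bucketOf (b : ℕ) (lo w x : ℝ) : ℕ := min ⌊(x - lo) / (w / b)⌋₊ (b - 1)

/-- The number of bucket operations made in the first `m` rounds when rank `ℓ` (counted from `1`)
is selected among the data `x i`, `i ∈ S`, which lie in the bucket that starts at `lo` and has
length `w`. If there is at most one datum, the algorithm has stopped. Otherwise each of the data
is assigned to one of `b` smaller buckets, at the cost of one operation per datum, and the
algorithm goes on in the bucket `r` that contains the datum of rank `ℓ`: the one with `F r < ℓ` and
`ℓ ≤ F (r + 1)`, where `F r` is the number of data in the buckets `0, …, r - 1`. -/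
def bucketOps {n : ℕ} (b : ℕ) (x : Fin n → ℝ) :
    (m : ℕ) → (lo w : ℝ) → (S : Finset (Fin n)) → (ℓ : ℕ) → ℕ
  | 0, _, _, _, _ => 0
  | m + 1, lo, w, S, ℓ =>
    if S.card ≤ 1 then 0
    else
      let F : ℕ → ℕ := fun r => (S.filter fun i => bucketOf b lo w (x i) < r).card
      S.card + ∑ r ∈ Finset.range b,
        if F r < ℓ ∧ ℓ ≤ F (r + 1) then
          bucketOps b x m (lo + r * (w / b)) (w / b)
            (S.filter fun i => bucketOf b lo w (x i) = r) (ℓ - F r)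
        else 0

/-- The total number `Y_n(ℓ)` of bucket operations needed to select rank `ℓ` among the data
`x 0, …, x (n - 1)` in `[0,1]`. It is infinite if the algorithm does not stop, which can only happen
if two of the data are equal. -/
def Y {n : ℕ} (b : ℕ) (x : Fin n → ℝ) (ℓ : ℕ) : ℕ∞ :=
  ⨆ m : ℕ, (bucketOps b x m 0 1 Finset.univ ℓ : ℕ∞)

/-- The value at `t` of the normalized process. The convention `Y_n(n + 1) := Y_n(n)` is the
minimum with `n`. Infinite values of `Y_n`, which have probability zero, are read as `0`. -/
def normalized {n : ℕ} (b : ℕ) (x : Fin n → ℝ) (t : I) : ℝ :=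
  (((Y b x (min (⌊(t : ℝ) * n⌋₊ + 1) n)).toNat : ℝ) - (b : ℝ) / ((b : ℝ) - 1) * n) / √n

lemma floor_right (n : ℕ) (t : I) :
    ∀ᶠ s : I in 𝓝[≥] t, ⌊(s : ℝ) * n⌋₊ = ⌊(t : ℝ) * n⌋₊ := by
  have hc : Tendsto (fun s : I => (s : ℝ) * n) (𝓝[≥] t) (𝓝[≥] ((t : ℝ) * n)) := by
    refine tendsto_nhdsWithin_iff.2 ⟨?_, ?_⟩
    · exact (Continuous.tendsto (by fun_prop) t).mono_left nhdsWithin_le_nhds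
    · filter_upwards [self_mem_nhdsWithin] with s hs
      exact mul_le_mul_of_nonneg_right (show (t : ℝ) ≤ s from hs) (Nat.cast_nonneg n)
  have := hc.eventually ((tendsto_floor_right_pure_floor ((t : ℝ) * n)).eventually
    (eventually_pure.2 rfl : ∀ᶠ z in pure ⌊(t : ℝ) * n⌋, z = ⌊(t : ℝ) * n⌋))
  filter_upwards [this] with s hs
  rw [← Int.floor_toNat, ← Int.floor_toNat, hs]

lemma floor_left (n : ℕ) (t : I) :
    ∃ k : ℕ, ∀ᶠ s : I in 𝓝[<] t, ⌊(s : ℝ) * n⌋₊ = k := by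
  rcases Nat.eq_zero_or_pos n with rfl | hn
  · exact ⟨0, by simp⟩
  have hc : Tendsto (fun s : I => (s : ℝ) * n) (𝓝[<] t) (𝓝[<] ((t : ℝ) * n)) := by
    refine tendsto_nhdsWithin_iff.2 ⟨?_, ?_⟩
    · exact (Continuous.tendsto (by fun_prop) t).mono_left nhdsWithin_le_nhds
    · filter_upwards [self_mem_nhdsWithin] with s hs
      exact mul_lt_mul_of_pos_right (show (s : ℝ) < t from hs) (Nat.cast_pos.2 hn)
  have := hc.eventually ((tendsto_floor_left_pure_ceil_sub_one ((t : ℝ) * n)).eventually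
    (eventually_pure.2 rfl : ∀ᶠ z in pure (⌈(t : ℝ) * n⌉ - 1), z = ⌈(t : ℝ) * n⌉ - 1))
  refine ⟨(⌈(t : ℝ) * n⌉ - 1).toNat, ?_⟩
  filter_upwards [this] with s hs
  rw [← Int.floor_toNat, hs]

/-- The path `X_n = (X_n(t))_{0 ≤ t ≤ 1}` for given data, as an element of `D[0,1]`. -/
def X {n : ℕ} (b : ℕ) (x : Fin n → ℝ) : Cadlag where
  toFun := normalized b x
  right_cont t := by
    refine tendsto_const_nhds.congr' ?_
    filter_upwards [floor_right n t] with s hs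
    simp only [normalized, hs]
  left_lim t := by
    obtain ⟨k, hk⟩ := floor_left n t
    refine ⟨(((Y b x (min (k + 1) n)).toNat : ℝ) - (b : ℝ) / ((b : ℝ) - 1) * n) / √n,
      tendsto_const_nhds.congr' ?_⟩
    filter_upwards [hk] with s hs
    simp only [normalized, hs]

/-! ### Common prefixes of `b`-ary expansions -/

/-- The digit `t_i`, `i ≥ 1`, of the `b`-ary expansion of `t ∈ [0,1]`. For `t < 1` it is the
expansion with infinitely many digits below `b - 1`; for `t = 1` all digits are `b - 1`. -/
def digit (b : ℕ) (t : I) (i : ℕ) : ℕ :=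
  if t = 1 then b - 1 else ⌊(t : ℝ) * (b : ℝ) ^ i⌋₊ % b

/-- The length `j(s,t)` of the longest common prefix of the `b`-ary expansions of `s` and `t`. -/
def prefixLength (b : ℕ) (s t : I) : ℕ∞ :=
  ⨆ (k : ℕ) (_ : ∀ i, 1 ≤ i → i ≤ k → digit b s i = digit b t i), (k : ℕ∞)

/-- `b ^ (-j)` for `j ∈ {0, 1, …, ∞}`, with `b ^ (-∞) = 0`. -/
def negPow (b : ℕ) (j : ℕ∞) : ℝ := if j = ⊤ then 0 else ((b : ℝ) ^ j.toNat)⁻¹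

end RadixSelection

end

noncomputable section

namespace RadixSelection

/-!
Let `N m` be the number of data in the level `m` cell around the selected one. The cost is the sum
of the `N m`, up to the small cells of the last levels. In terms of the innovations
`D m = N m - N (m - 1) / b`, which are centered and uncorrelated along a path, it equals
`b / (b - 1) * (n + ∑ D m)`. By the multivariate central limit theorem, the first `K` levels of
`D / √n` converge to Gaussian innovations: independent Gaussian noise on the cells minus its average
over siblings. Their sum along the path to `t` is a uniform limit of step functions, hence càdlàg.
A fourth moment bound for the innovations makes the levels above `K` uniformly small. Finally, the
empirical quantile `t` sits near, but not at, the point `t`; a piecewise linear time change that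
maps rank boundaries of the cells to cell boundaries absorbs this in the Skorokhod metric.
-/

section Cells

/-! ### Cells of the `b`-ary subdivisions -/

/-- The number of the cell of the `k`-th `b`-ary subdivision of `[0,1]` that contains `u`; the
right endpoint `1` belongs to the last cell. -/
def cell (b k : ℕ) (u : ℝ) : ℕ := min ⌊u * (b : ℝ) ^ k⌋₊ (b ^ k - 1)

variable {b : ℕ}

lemma cell_lt (hb : 0 < b) (k : ℕ) (u : ℝ) : cell b k u < b ^ k :=
  (min_le_right _ _).trans_lt (Nat.sub_one_lt_of_lt (by positivity))

lemma cell_zero (b : ℕ) (u : ℝ) : cell b 0 u = 0 := by simp [cell]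

lemma cell_mono (b k : ℕ) : Monotone (cell b k) := fun u v h => by
  unfold cell
  gcongr

lemma floor_mul_pow_succ_div (hb : 0 < b) (k : ℕ) (u : ℝ) :
    ⌊u * (b : ℝ) ^ (k + 1)⌋₊ / b = ⌊u * (b : ℝ) ^ k⌋₊ := by
  rw [← Nat.floor_div_natCast, pow_succ, ← mul_assoc, mul_div_cancel_right₀ _ (by positivity)]

lemma cell_succ_div (hb : 0 < b) (k : ℕ) (u : ℝ) : cell b (k + 1) u / b = cell b k u := by
  have hmono : Monotone fun a : ℕ => a / b := fun _ _ h => Nat.div_le_div_right h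
  have hlast : (b ^ (k + 1) - 1) / b = b ^ k - 1 := by
    simpa [pow_succ'] using Nat.mul_sub_div 0 b (b ^ k) (by positivity)
  rw [cell, hmono.map_min, hlast, floor_mul_pow_succ_div hb, cell]

lemma cell_div_pow (hb : 0 < b) (k l : ℕ) (u : ℝ) : cell b (k + l) u / b ^ l = cell b k u := by
  induction l with
  | zero => simp
  | succ l ih => rw [pow_succ', ← Nat.div_div_eq_div_mul, ← add_assoc, cell_succ_div hb, ih]

lemma cell_eq_of_le (hb : 0 < b) {k l : ℕ} (hkl : k ≤ l) {u v : ℝ}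
    (h : cell b l u = cell b l v) : cell b k u = cell b k v := by
  obtain ⟨d, rfl⟩ := Nat.exists_eq_add_of_le hkl
  rw [← cell_div_pow hb k d, ← cell_div_pow hb k d, h]

lemma mul_cell_add_mod (hb : 0 < b) (k : ℕ) (u : ℝ) :
    b * cell b k u + cell b (k + 1) u % b = cell b (k + 1) u := by
  rw [← cell_succ_div hb, Nat.div_add_mod]

lemma mul_min_div_add_min_sub (hb : 0 < b) {N : ℕ} (hN : 0 < N) (f : ℕ) :
    b * min (f / b) (N - 1) + min (f - min (f / b) (N - 1) * b) (b - 1) = min f (b * N - 1) := by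
  have hlt := Nat.mod_lt f hb
  have hf := Nat.div_add_mod f b
  obtain ⟨N, rfl⟩ := Nat.exists_eq_succ_of_ne_zero hN.ne'
  rcases le_or_gt (f / b) N with h | h
  · have := Nat.mul_le_mul_left b h
    rw [Nat.succ_sub_one, min_eq_left h, mul_comm (f / b), Nat.mul_succ]
    omega
  · have := Nat.mul_le_mul_left b h
    rw [Nat.mul_succ] at this
    rw [Nat.succ_sub_one, min_eq_right h.le, mul_comm N, Nat.mul_succ]
    omega

lemma mul_cell_add_bucketOf (hb : 0 < b) (k : ℕ) (u : ℝ) :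
    b * cell b k u + bucketOf b (cell b k u / (b : ℝ) ^ k) ((b : ℝ) ^ k)⁻¹ u =
      cell b (k + 1) u := by
  have : (b : ℝ) ≠ 0 := by positivity
  have harg : (u - cell b k u / (b : ℝ) ^ k) / (((b : ℝ) ^ k)⁻¹ / b) =
      u * (b : ℝ) ^ (k + 1) - ((cell b k u * b : ℕ) : ℝ) := by
    push_cast
    field_simp
    ring
  rw [bucketOf, harg, Nat.floor_sub_natCast, cell, cell, ← floor_mul_pow_succ_div hb,
    mul_min_div_add_min_sub hb (by positivity), pow_succ' b k]

end Cells

section Costs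

/-! ### The costs in terms of the occupation numbers of the cells -/

variable {n b : ℕ}

/-- The set of the data in cell `i` of level `k`. -/
def cellData (b : ℕ) (x : Fin n → ℝ) (k i : ℕ) : Finset (Fin n) :=
  Finset.univ.filter fun j => cell b k (x j) = i

/-- The number of data in cell `i` of level `k`. -/
def count (b : ℕ) (x : Fin n → ℝ) (k i : ℕ) : ℕ := (cellData b x k i).card

/-- The number of data in the cells of level `k` to the left of cell `i`. -/
def below (b : ℕ) (x : Fin n → ℝ) (k i : ℕ) : ℕ :=
  (Finset.univ.filter fun j => cell b k (x j) < i).card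

/-- The rank of a datum, counted from `1`. -/
def rank (x : Fin n → ℝ) (j : Fin n) : ℕ := (Finset.univ.filter fun i => x i < x j).card + 1

/-- The cost of splitting a bucket that contains `N` data. -/
def splitCost (N : ℕ) : ℕ := if N ≤ 1 then 0 else N

/-- The cost of the first `m` rounds of the selection of rank `ℓ` among all data, if it is started
in cell `i` of level `k`. -/
def opsFrom (b : ℕ) (x : Fin n → ℝ) (m k i ℓ : ℕ) : ℕ :=
  bucketOps b x m (i / (b : ℝ) ^ k) ((b : ℝ) ^ k)⁻¹ (cellData b x k i) (ℓ - below b x k i)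

@[simp]
lemma mem_cellData {x : Fin n → ℝ} {k i : ℕ} {j : Fin n} :
    j ∈ cellData b x k i ↔ cell b k (x j) = i := by simp [cellData]

lemma below_mono (x : Fin n → ℝ) (k : ℕ) : Monotone (below b x k) := fun _ _ h =>
  Finset.card_le_card <| Finset.monotone_filter_right _ fun _ _ hj => hj.trans_le h

lemma below_eq_sum (x : Fin n → ℝ) (k i : ℕ) :
    below b x k i = ∑ l ∈ Finset.range i, count b x k l := by
  rw [below, Finset.card_eq_sum_card_fiberwise (f := fun j => cell b k (x j))
    (t := Finset.range i) (by intro j; simp)]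
  refine Finset.sum_congr rfl fun l hl => congrArg Finset.card ?_
  ext j
  have := Finset.mem_range.1 hl
  simp only [Finset.mem_filter, Finset.mem_univ, true_and, mem_cellData]
  omega

lemma below_pow (hb : 0 < b) (x : Fin n → ℝ) (k : ℕ) : below b x k (b ^ k) = n := by
  simp [below, cell_lt hb]

lemma below_succ_mul (hb : 0 < b) (x : Fin n → ℝ) (k i : ℕ) :
    below b x (k + 1) (b * i) = below b x k i := by
  simp only [below, ← cell_succ_div hb k, Nat.div_lt_iff_lt_mul hb, mul_comm b i]

lemma below_cell_lt_rank (x : Fin n → ℝ) (k : ℕ) (j : Fin n) :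
    below b x k (cell b k (x j)) < rank x j :=
  Nat.lt_succ_of_le <| Finset.card_le_card <|
    Finset.monotone_filter_right _ fun _ _ hi => (cell_mono b k).reflect_lt hi

lemma rank_le_below_cell (x : Fin n → ℝ) (k : ℕ) (j : Fin n) :
    rank x j ≤ below b x k (cell b k (x j) + 1) := by
  rw [rank, below, ← Finset.card_insert_of_notMem (a := j) (by simp)]
  refine Finset.card_le_card fun i hi => ?_
  simp only [Finset.mem_filter, Finset.mem_univ, true_and, Finset.mem_insert] at hi ⊢
  rcases hi with rfl | hi
  · exact Nat.lt_succ_self _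
  · exact Nat.lt_succ_of_le (cell_mono b k hi.le)

lemma cell_eq_iff_rank {x : Fin n → ℝ} {k i : ℕ} {j : Fin n} :
    cell b k (x j) = i ↔ below b x k i < rank x j ∧ rank x j ≤ below b x k (i + 1) := by
  have hlt := below_cell_lt_rank (b := b) x k j
  have hle := rank_le_below_cell (b := b) x k j
  refine ⟨fun h => h ▸ ⟨hlt, hle⟩, fun ⟨h, h'⟩ => le_antisymm ?_ ?_⟩ <;> by_contra! hne
  · exact absurd (below_mono x k hne) (h'.trans_lt' hlt).not_ge
  · exact absurd (below_mono x k hne) (h.trans_le hle).not_ge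

lemma rank_lt_rank {x : Fin n → ℝ} {i j : Fin n} (h : x i < x j) : rank x i < rank x j :=
  Nat.succ_lt_succ <| Finset.card_lt_card <| Finset.ssubset_iff_of_subset
    (Finset.monotone_filter_right _ fun _ _ hl => hl.trans h) |>.2 ⟨i, by simpa using h⟩

lemma rank_le (x : Fin n → ℝ) (j : Fin n) : rank x j ≤ n := by
  have : (Finset.univ.filter fun i => x i < x j) ⊂ Finset.univ :=
    Finset.filter_ssubset.2 ⟨j, Finset.mem_univ _, lt_irrefl _⟩
  exact Nat.succ_le_of_lt (by simpa using Finset.card_lt_card this)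

lemma exists_rank_eq {x : Fin n → ℝ} (hx : Function.Injective x) {r : ℕ} (h1 : 1 ≤ r)
    (hn : r ≤ n) : ∃ j, rank x j = r := by
  have hinj : Function.Injective (rank x) := fun i j h => by
    by_contra hne
    rcases lt_or_gt_of_ne (hx.ne hne) with hlt | hlt
    · exact (rank_lt_rank hlt).ne h
    · exact (rank_lt_rank hlt).ne' h
  have himage : Finset.univ.image (rank x) = Finset.Icc 1 n :=
    Finset.eq_of_subset_of_card_le
      (Finset.image_subset_iff.2 fun j _ => Finset.mem_Icc.2 ⟨Nat.le_add_left 1 _, rank_le x j⟩)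
      (by rw [Finset.card_image_of_injective _ hinj]; simp)
  have hr : r ∈ Finset.univ.image (rank x) := himage ▸ Finset.mem_Icc.2 ⟨h1, hn⟩
  simpa using hr

lemma antitone_count_cell (hb : 0 < b) (x : Fin n → ℝ) (u : ℝ) :
    Antitone fun k => count b x k (cell b k u) := fun _ _ h =>
  Finset.card_le_card <| Finset.monotone_filter_right _ fun _ _ hj => cell_eq_of_le hb h hj

lemma filter_cellData_bucketOf_eq (hb : 0 < b) (x : Fin n → ℝ) (k i : ℕ) {r : ℕ} (hr : r < b) :
    ((cellData b x k i).filter fun j =>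
        bucketOf b (i / (b : ℝ) ^ k) ((b : ℝ) ^ k)⁻¹ (x j) = r) =
      cellData b x (k + 1) (b * i + r) := by
  ext j
  have hbucket := mul_cell_add_bucketOf hb k (x j)
  simp only [Finset.mem_filter, mem_cellData]
  constructor
  · rintro ⟨rfl, hj⟩
    rw [← hbucket, hj]
  · intro hj
    have hi : cell b k (x j) = i := by
      rw [← cell_succ_div hb, hj, Nat.mul_add_div hb, Nat.div_eq_of_lt hr, add_zero]
    rw [hi, hj] at hbucket
    exact ⟨hi, Nat.add_left_cancel hbucket⟩

lemma below_add_card_filter_bucketOf_lt (hb : 0 < b) (x : Fin n → ℝ) (k i : ℕ) {r : ℕ}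
    (hr : r ≤ b) :
    below b x k i + ((cellData b x k i).filter fun j =>
        bucketOf b (i / (b : ℝ) ^ k) ((b : ℝ) ^ k)⁻¹ (x j) < r).card =
      below b x (k + 1) (b * i + r) := by
  rw [below_eq_sum x (k + 1), Finset.sum_range_add, ← below_eq_sum, below_succ_mul hb]
  congr 1
  rw [Finset.card_eq_sum_card_fiberwise
    (f := fun j => bucketOf b (i / (b : ℝ) ^ k) ((b : ℝ) ^ k)⁻¹ (x j))
    (t := Finset.range r) (by intro j; simp)]
  refine Finset.sum_congr rfl fun s hs => ?_
  have hs := Finset.mem_range.1 hs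
  rw [count, ← filter_cellData_bucketOf_eq hb x k i (hs.trans_le hr), Finset.filter_filter]
  congr 2
  ext j
  omega

lemma opsFrom_succ (hb : 0 < b) (x : Fin n → ℝ) (m : ℕ) {k i ℓ : ℕ} (hℓ : below b x k i < ℓ) :
    opsFrom b x (m + 1) k i ℓ =
      if count b x k i ≤ 1 then 0
      else count b x k i + ∑ r ∈ Finset.range b,
        if below b x (k + 1) (b * i + r) < ℓ ∧ ℓ ≤ below b x (k + 1) (b * i + r + 1) then
          opsFrom b x m (k + 1) (b * i + r) ℓ
        else 0 := by
  rw [opsFrom, bucketOps, ← count]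
  refine if_congr Iff.rfl rfl (congrArg _ <| Finset.sum_congr rfl fun r hr => ?_)
  have hr := Finset.mem_range.1 hr
  have h0 := below_add_card_filter_bucketOf_lt hb x k i hr.le
  have h1 := below_add_card_filter_bucketOf_lt hb x k i hr
  rw [Nat.succ_eq_add_one, ← add_assoc] at h1
  have hlo : (i : ℝ) / (b : ℝ) ^ k + r * (((b : ℝ) ^ k)⁻¹ / b) =
      (b * i + r : ℕ) / (b : ℝ) ^ (k + 1) := by
    push_cast
    field_simp
    ring
  have hw : ((b : ℝ) ^ k)⁻¹ / b = ((b : ℝ) ^ (k + 1))⁻¹ := by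
    rw [pow_succ, mul_inv, div_eq_mul_inv]
  refine if_congr (by beta_reduce; omega) ?_ rfl
  rw [opsFrom, hlo, hw, filter_cellData_bucketOf_eq hb x k i hr, ← h0, Nat.sub_sub]

lemma opsFrom_cell_rank_succ (hb : 0 < b) (x : Fin n → ℝ) (j : Fin n) (m k : ℕ) :
    opsFrom b x (m + 1) k (cell b k (x j)) (rank x j) =
      if count b x k (cell b k (x j)) ≤ 1 then 0
      else count b x k (cell b k (x j)) +
        opsFrom b x m (k + 1) (cell b (k + 1) (x j)) (rank x j) := by
  have hmod := mul_cell_add_mod hb k (x j)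
  rw [opsFrom_succ hb x m (below_cell_lt_rank x k j)]
  simp_rw [← cell_eq_iff_rank]
  rw [Finset.sum_eq_single (cell b (k + 1) (x j) % b), if_pos hmod.symm, hmod]
  · exact fun r _ hne => if_neg fun h => hne (by omega)
  · exact fun h => absurd (Finset.mem_range.2 (Nat.mod_lt _ hb)) h

lemma opsFrom_cell_rank (hb : 0 < b) (x : Fin n → ℝ) (j : Fin n) (m k : ℕ) :
    opsFrom b x m k (cell b k (x j)) (rank x j) =
      ∑ l ∈ Finset.range m, splitCost (count b x (k + l) (cell b (k + l) (x j))) := by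
  induction m generalizing k with
  | zero => simp [opsFrom, bucketOps]
  | succ m ih =>
    rw [opsFrom_cell_rank_succ hb, ih]
    split_ifs with hle
    · refine (Finset.sum_eq_zero fun l _ => if_pos ?_).symm
      exact (antitone_count_cell hb x (x j) (Nat.le_add_right k l)).trans hle
    · rw [Finset.sum_range_succ', add_comm, add_zero, splitCost, if_neg hle]
      simp only [add_assoc, add_comm 1]

lemma bucketOps_univ_rank (hb : 0 < b) (x : Fin n → ℝ) (j : Fin n) (m : ℕ) :
    bucketOps b x m 0 1 Finset.univ (rank x j) =
      ∑ l ∈ Finset.range m, splitCost (count b x l (cell b l (x j))) := by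
  simpa [opsFrom, below, cellData, cell_zero] using opsFrom_cell_rank hb x j m 0

lemma Y_rank (hb : 0 < b) (x : Fin n → ℝ) (j : Fin n) {m : ℕ} (hm : ∀ i, count b x m i ≤ 1) :
    Y b x (rank x j) =
      (∑ l ∈ Finset.range m, splitCost (count b x l (cell b l (x j))) : ℕ) := by
  simp_rw [Y, bucketOps_univ_rank hb]
  refine le_antisymm (iSup_le fun m' => Nat.cast_le.2 ?_) (le_iSup_of_le m le_rfl)
  rcases le_total m' m with h | h
  · exact Finset.sum_le_sum_of_subset (Finset.range_mono h)
  · refine (Finset.sum_subset (Finset.range_mono h) fun l _ hl => if_pos ?_).ge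
    exact (antitone_count_cell hb x (x j) (not_lt.1 fun h => hl (Finset.mem_range.2 h))).trans
      (hm _)

lemma injective_of_count_le_one {x : Fin n → ℝ} {m : ℕ} (hm : ∀ i, count b x m i ≤ 1) :
    Function.Injective x := fun i j hij =>
  Finset.card_le_one.1 (hm (cell b m (x j))) i (by simp [hij]) j (by simp)

end Costs

section Measurability

/-! ### Measurability of the normalized process -/

lemma measurable_bucketOf (b : ℕ) (lo w : ℝ) : Measurable (bucketOf b lo w) :=
  (Nat.measurable_floor.comp (by fun_prop)).min measurable_const

lemma measurable_bucketOps (b : ℕ) {n : ℕ} (m : ℕ) (lo w : ℝ) (S : Finset (Fin n)) (ℓ : ℕ) :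
    Measurable fun x : Fin n → ℝ => bucketOps b x m lo w S ℓ := by
  induction m generalizing lo w S ℓ with
  | zero => simp [bucketOps]
  | succ m ih =>
    unfold bucketOps
    split_ifs
    · exact measurable_const
    have hbuckets : Measurable fun (x : Fin n → ℝ) i => bucketOf b lo w (x i) :=
      measurable_pi_lambda _ fun i => (measurable_bucketOf b lo w).comp (measurable_pi_apply i)
    let ops (p : (Fin n → ℝ) × (Fin n → ℕ)) : ℕ :=
      S.card + ∑ r ∈ Finset.range b,
        if (S.filter fun i => p.2 i < r).card < ℓ ∧ ℓ ≤ (S.filter fun i => p.2 i < r + 1).card then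
          bucketOps b p.1 m (lo + r * (w / b)) (w / b) (S.filter fun i => p.2 i = r)
            (ℓ - (S.filter fun i => p.2 i < r).card)
        else 0
    have hops : Measurable ops := measurable_from_prod_countable_left fun c => by
      refine measurable_const.add (Finset.measurable_fun_sum _ fun r _ => ?_)
      by_cases h : (S.filter fun i => c i < r).card < ℓ ∧ ℓ ≤ (S.filter fun i => c i < r + 1).card
      · simpa only [if_pos h] using ih ..
      · simpa only [if_neg h] using measurable_const
    simpa only [ops, Function.comp_def, id] using hops.comp (measurable_id.prodMk hbuckets)

lemma measurable_Y (b : ℕ) {n : ℕ} (ℓ : ℕ) : Measurable fun x : Fin n → ℝ => Y b x ℓ := by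
  have : BorelSpace ℕ∞ := ⟨borel_eq_top_of_countable.symm⟩
  exact Measurable.iSup fun m => measurable_from_nat.comp (measurable_bucketOps b m 0 1 _ ℓ)

lemma measurable_X (b n : ℕ) : Measurable (X b : (Fin n → ℝ) → Cadlag) := by
  let ops (x : Fin n → ℝ) (ℓ : Fin (n + 1)) : ℕ := (Y b x ℓ).toNat
  have hops : Measurable ops :=
    measurable_pi_lambda _ fun ℓ => Measurable.of_discrete.comp (measurable_Y b ℓ)
  have hfactor : (X b).FactorsThrough ops := fun x y h => by
    ext t
    have := congrFun h ⟨min (⌊(t : ℝ) * n⌋₊ + 1) n, by omega⟩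
    simp only [ops] at this
    simp only [X, normalized, this]
  have : Nonempty Cadlag := ⟨X b (0 : Fin n → ℝ)⟩
  obtain ⟨F, hF⟩ := (Function.factorsThrough_iff _).1 hfactor
  exact hF ▸ Measurable.of_discrete.comp hops

end Measurability

section Approximation

/-! ### Convergence in distribution by approximation -/

lemma tendsto_of_forall_approx {ι κ E : Type*} [PseudoMetricSpace E] {l : Filter ι} {a : ι → E}
    {b : κ → ι → E} {c : E} {d : κ → E} (hb : ∀ k, Tendsto (b k) l (𝓝 (d k)))
    (h : ∀ ε > 0, ∃ k, (∀ᶠ i in l, dist (a i) (b k i) ≤ ε) ∧ dist (d k) c ≤ ε) :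
    Tendsto a l (𝓝 c) := by
  refine Metric.tendsto_nhds.2 fun ε hε => ?_
  obtain ⟨k, hab, hdc⟩ := h (ε / 3) (by positivity)
  filter_upwards [hab, Metric.tendsto_nhds.1 (hb k) (ε / 3) (by positivity)] with i h1 h2
  linarith [dist_triangle4 (a i) (b k i) (d k) c]

lemma abs_sub_le_add_indicator {E Ω : Type*} [PseudoMetricSpace E] {f : E → ℝ} {C : ℝ}
    {L : NNReal} {A B : Ω → E} (hC : ∀ x y, dist (f x) (f y) ≤ C)
    (hL : LipschitzWith L f) {ε : ℝ} (hε : 0 ≤ ε) {s : Set Ω}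
    (hs : {ω | ε < dist (A ω) (B ω)} ⊆ s) (ω : Ω) :
    |f (A ω) - f (B ω)| ≤ L * ε + s.indicator (fun _ => C) ω := by
  rw [← Real.dist_eq]
  by_cases hω : ω ∈ s
  · rw [Set.indicator_of_mem hω]
    exact (hC _ _).trans (le_add_of_nonneg_left (by positivity))
  · rw [Set.indicator_of_notMem hω, add_zero]
    exact (hL.dist_le_mul _ _).trans (by gcongr; exact not_lt.1 fun h => hω (hs h))

variable {E : Type*} [PseudoMetricSpace E] [MeasurableSpace E] [OpensMeasurableSpace E]
  {ι : Type*} {Ω : ι → Type*} {mΩ : ∀ i, MeasurableSpace (Ω i)} {P : ∀ i, Measure (Ω i)}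
  [∀ i, IsProbabilityMeasure (P i)] {Ω' : Type*} {mΩ' : MeasurableSpace Ω'} {P' : Measure Ω'}
  [IsProbabilityMeasure P'] {l : Filter ι} {f : E → ℝ} {C : ℝ} {L : NNReal}

lemma tendstoInDistribution_iff_forall_lipschitz [l.IsCountablyGenerated] {A : ∀ i, Ω i → E}
    {G : Ω' → E} (hA : ∀ i, AEMeasurable (A i) (P i)) (hG : AEMeasurable G P') :
    TendstoInDistribution A l G P P' ↔
      ∀ f : E → ℝ, (∃ C : ℝ, ∀ x y, dist (f x) (f y) ≤ C) → (∃ L, LipschitzWith L f) →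
        Tendsto (fun i => ∫ ω, f (A i ω) ∂P i) l (𝓝 (∫ ω, f (G ω) ∂P')) := by
  have hiff : TendstoInDistribution A l G P P' ↔ Tendsto (β := ProbabilityMeasure E)
      (fun i => ⟨(P i).map (A i), Measure.isProbabilityMeasure_map (hA i)⟩) l
      (𝓝 ⟨P'.map G, Measure.isProbabilityMeasure_map hG⟩) :=
    ⟨fun h => h.tendsto, fun h => ⟨hA, hG, h⟩⟩
  refine hiff.trans <| tendsto_iff_forall_lipschitz_integral_tendsto.trans ?_
  refine forall₃_congr fun f _ ⟨L, hL⟩ => ?_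
  have hf {μ : Measure E} : AEStronglyMeasurable f μ :=
    hL.continuous.measurable.aestronglyMeasurable
  simp only [ProbabilityMeasure.coe_mk, integral_map hG hf]
  simp_rw [fun i => integral_map (hA i) (hf (μ := (P i).map (A i)))]

lemma integrable_comp_of_forall_dist_le {A : Ω' → E} (hA : AEMeasurable A P')
    (hC : ∀ x y, dist (f x) (f y) ≤ C) (hf : Continuous f) :
    Integrable (fun ω => f (A ω)) P' := by
  obtain ⟨ω₀⟩ : Nonempty Ω' := nonempty_of_isProbabilityMeasure P'
  refine .of_bound (hf.measurable.comp_aemeasurable hA).aestronglyMeasurable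
    (‖f (A ω₀)‖ + C) (.of_forall fun ω => ?_)
  exact (norm_le_norm_add_norm_sub' _ _).trans (by gcongr; exact dist_eq_norm (f _) _ ▸ hC _ _)

lemma abs_integral_comp_sub_le {A B : Ω' → E} (hA : AEMeasurable A P') (hB : AEMeasurable B P')
    (hC : ∀ x y, dist (f x) (f y) ≤ C) (hC0 : 0 ≤ C) (hL : LipschitzWith L f) {ε : ℝ}
    (hε : 0 ≤ ε) (hd : P'.real {ω | ε < dist (A ω) (B ω)} ≤ ε) :
    |∫ ω, f (A ω) ∂P' - ∫ ω, f (B ω) ∂P'| ≤ (L + C) * ε := by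
  set s := toMeasurable P' {ω | ε < dist (A ω) (B ω)}
  have hs : MeasurableSet s := measurableSet_toMeasurable _ _
  have hPs : P'.real s ≤ ε := by rwa [measureReal_def, measure_toMeasurable]
  have iA := integrable_comp_of_forall_dist_le hA hC hL.continuous
  have iB := integrable_comp_of_forall_dist_le hB hC hL.continuous
  have iC : Integrable (s.indicator fun _ => C) P' := (integrable_const C).indicator hs
  calc |∫ ω, f (A ω) ∂P' - ∫ ω, f (B ω) ∂P'|
      ≤ ∫ ω, |f (A ω) - f (B ω)| ∂P' := by
        rw [← integral_sub iA iB]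
        exact abs_integral_le_integral_abs
    _ ≤ ∫ ω, (L * ε + s.indicator (fun _ => C) ω) ∂P' :=
        integral_mono (iA.sub iB).abs ((integrable_const _).add iC)
          (abs_sub_le_add_indicator hC hL hε (subset_toMeasurable _ _))
    _ = L * ε + P'.real s * C := by
        rw [integral_add (integrable_const _) iC, integral_indicator_const _ hs]
        simp
    _ ≤ (L + C) * ε := by
        rw [add_mul, mul_comm (C : ℝ)]
        gcongr

theorem tendstoInDistribution_of_forall_approx [l.IsCountablyGenerated] {κ : Type*}
    {A : ∀ i, Ω i → E} {T : κ → ∀ i, Ω i → E} {G : Ω' → E} {H : κ → Ω' → E}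
    (hA : ∀ i, AEMeasurable (A i) (P i)) (hG : AEMeasurable G P')
    (hT : ∀ k, TendstoInDistribution (T k) l (H k) P P')
    (happrox : ∀ ε > 0, ∃ k,
      (∀ᶠ i in l, (P i).real {ω | ε < dist (A i ω) (T k i ω)} ≤ ε) ∧
      P'.real {ω | ε < dist (H k ω) (G ω)} ≤ ε) :
    TendstoInDistribution A l G P P' := by
  refine (tendstoInDistribution_iff_forall_lipschitz hA hG).2 fun f ⟨C, hC⟩ ⟨L, hL⟩ => ?_
  obtain ⟨ω₀⟩ : Nonempty Ω' := nonempty_of_isProbabilityMeasure P'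
  have hC0 : 0 ≤ C := dist_nonneg.trans (hC (G ω₀) (G ω₀))
  have hTm (k : κ) := (hT k).forall_aemeasurable
  have hHm (k : κ) := (hT k).aemeasurable_limit
  refine tendsto_of_forall_approx (fun k => (tendstoInDistribution_iff_forall_lipschitz
    (hTm k) (hHm k)).1 (hT k) f ⟨C, hC⟩ ⟨L, hL⟩) fun δ hδ => ?_
  obtain ⟨k, hk, hk'⟩ := happrox (δ / (L + C + 1)) (by positivity)
  have hδ' : (L + C) * (δ / (L + C + 1)) ≤ δ := by
    rw [mul_div_left_comm]
    exact mul_le_of_le_one_right hδ.le (div_le_one_of_le₀ (by linarith) (by positivity))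
  refine ⟨k, hk.mono fun i hi => ?_, ?_⟩
  · exact (abs_integral_comp_sub_le (hA i) (hTm k i) hC hC0 hL (by positivity) hi).trans hδ'
  · exact (abs_integral_comp_sub_le (hHm k) hG hC hC0 hL (by positivity) hk').trans hδ'

end Approximation

section StepFunctions

/-! ### Step functions -/

variable {b : ℕ}

lemma SkorokhodClose.dist_le {x y : Cadlag} {ε : ℝ} (h : SkorokhodClose x y ε) : dist x y ≤ ε :=
  csInf_le (bddBelow_skorokhodClose x y) h

lemma dist_le_of_forall_abs_sub_le {x y : Cadlag} {ε : ℝ} (h : ∀ t, |x t - y t| ≤ ε) :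
    dist x y ≤ ε :=
  SkorokhodClose.dist_le ⟨OrderIso.refl I, fun t =>
    ⟨by simpa using (abs_nonneg _).trans (h 0), h t⟩⟩

lemma eventually_cell_eq_nhdsGE (b k : ℕ) (t : I) :
    ∀ᶠ s : I in 𝓝[≥] t, cell b k s = cell b k t := by
  filter_upwards [floor_right (b ^ k) t] with s hs
  push_cast at hs
  simp only [cell, hs]

lemma exists_eventually_cell_eq_nhdsLT (b k : ℕ) (t : I) :
    ∃ i, ∀ᶠ s : I in 𝓝[<] t, cell b k s = i := by
  obtain ⟨i, hi⟩ := floor_left (b ^ k) t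
  refine ⟨min i (b ^ k - 1), hi.mono fun s hs => ?_⟩
  push_cast at hs
  simp only [cell, hs]

/-- The càdlàg step function that has the value `z i` on cell `i` of level `k`. -/
def stepFun (hb : 0 < b) (k : ℕ) (z : Fin (b ^ k) → ℝ) : Cadlag where
  toFun t := z ⟨cell b k t, cell_lt hb k t⟩
  right_cont t := tendsto_const_nhds.congr' <|
    (eventually_cell_eq_nhdsGE b k t).mono fun _ hs => congrArg z (Fin.ext hs.symm)
  left_lim t := by
    obtain ⟨i, hi⟩ := exists_eventually_cell_eq_nhdsLT b k t
    by_cases hik : i < b ^ k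
    · exact ⟨z ⟨i, hik⟩, tendsto_const_nhds.congr' <|
        hi.mono fun _ hs => congrArg z (Fin.ext hs.symm)⟩
    · exact ⟨0, tendsto_const_nhds.congr' <|
        hi.mono fun s hs => absurd (hs ▸ cell_lt hb k s) hik⟩

lemma continuous_stepFun (hb : 0 < b) (k : ℕ) : Continuous (stepFun hb k) :=
  LipschitzWith.continuous (K := 1) <| .of_dist_le_mul fun z w => by
    rw [NNReal.coe_one, one_mul]
    exact dist_le_of_forall_abs_sub_le fun t => dist_le_pi_dist z w _

/-- The left end point of cell `i` of level `k`. -/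
def leftEnd (hb : 0 < b) (k : ℕ) (i : Fin (b ^ k)) : I :=
  ⟨i / (b : ℝ) ^ k, by positivity, div_le_one_of_le₀ (by exact_mod_cast i.2.le) (by positivity)⟩

lemma cell_leftEnd (hb : 0 < b) (k : ℕ) (i : Fin (b ^ k)) : cell b k (leftEnd hb k i) = i := by
  have hbk : (b : ℝ) ^ k ≠ 0 := by positivity
  rw [cell, leftEnd, div_mul_cancel₀ _ hbk, Nat.floor_natCast,
    min_eq_left (Nat.le_sub_one_of_lt i.2)]

lemma stepFun_comp_leftEnd (hb : 0 < b) {k : ℕ} {f : I → ℝ}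
    (hf : ∀ s t : I, cell b k s = cell b k t → f s = f t) (t : I) :
    stepFun hb k (f ∘ leftEnd hb k) t = f t :=
  hf _ _ (cell_leftEnd hb k ⟨cell b k t, cell_lt hb k t⟩)

end StepFunctions

section PathSums

/-! ### Sums along paths in the tree of cells -/

variable {b : ℕ}

/-- The sum of the values `z m i` along the path of the cells that contain `t`, over the levels
`1, …, K`. -/
def pathSum (b K : ℕ) (z : ℕ → ℕ → ℝ) (t : ℝ) : ℝ :=
  ∑ m ∈ Finset.range K, z (m + 1) (cell b (m + 1) t)

lemma pathSum_eq_of_cell_eq (hb : 0 < b) {K : ℕ} (z : ℕ → ℕ → ℝ) {s t : ℝ}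
    (h : cell b K s = cell b K t) : pathSum b K z s = pathSum b K z t :=
  Finset.sum_congr rfl fun m hm => by rw [cell_eq_of_le hb (Finset.mem_range.1 hm) h]

/-- `pathSum b K z` as an element of `D[0,1]`. -/
def pathStep (hb : 0 < b) (K : ℕ) (z : ℕ → ℕ → ℝ) : Cadlag :=
  stepFun hb K fun i => pathSum b K z (leftEnd hb K i)

lemma pathStep_apply (hb : 0 < b) (K : ℕ) (z : ℕ → ℕ → ℝ) (t : I) :
    pathStep hb K z t = pathSum b K z t :=
  stepFun_comp_leftEnd hb (f := fun t : I => pathSum b K z t)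
    (fun _ _ h => pathSum_eq_of_cell_eq hb z h) t

/-- The covariance of the deviations `ξ i - (ξ (b * (i / b)) + ⋯ + ξ (b * (i / b) + b - 1)) / b` of
uncorrelated random variables `ξ i` of variance `1` from the mean over their siblings. -/
def siblingCov (b i j : ℕ) : ℝ := if i / b = j / b then (if i = j then 1 else 0) - (b : ℝ)⁻¹ else 0

/-- The covariance of the innovations in the cells `i` and `j` of level `m`. -/
def innovCov (b m i j : ℕ) : ℝ :=
  ((b : ℝ) / ((b : ℝ) - 1)) ^ 2 * ((b : ℝ) ^ m)⁻¹ * siblingCov b i j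

/-- The covariance of the sums of the innovations along the first `K` levels of the paths of two
points. -/
def pathCov (b K : ℕ) (s t : ℝ) : ℝ :=
  ∑ m ∈ Finset.range K, innovCov b (m + 1) (cell b (m + 1) s) (cell b (m + 1) t)

lemma innovCov_self (hb : 1 < b) (m i : ℕ) :
    innovCov b m i i = (b : ℝ) / ((b : ℝ) - 1) * ((b : ℝ) ^ m)⁻¹ := by
  have hb1 : (b : ℝ) - 1 ≠ 0 := sub_ne_zero.2 (by exact_mod_cast hb.ne')
  have hb0 : (b : ℝ) ≠ 0 := by positivity
  rw [innovCov, siblingCov, if_pos rfl, if_pos rfl]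
  field_simp

lemma pathCov_of_cell_eq (hb : 1 < b) {K : ℕ} {s t : ℝ} (h : cell b K s = cell b K t) :
    pathCov b K s t = (b : ℝ) / ((b : ℝ) - 1) ^ 2 * (1 - ((b : ℝ) ^ K)⁻¹) := by
  have hb1 : (b : ℝ) - 1 ≠ 0 := sub_ne_zero.2 (by exact_mod_cast hb.ne')
  have hb0 : (b : ℝ) ≠ 0 := by positivity
  induction K with
  | zero => simp [pathCov]
  | succ K ih =>
    rw [pathCov, Finset.sum_range_succ, ← pathCov, ih (cell_eq_of_le hb.pos K.le_succ h), h,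
      innovCov_self hb, pow_succ]
    field_simp
    ring

lemma pathCov_of_cell_ne (hb : 1 < b) {K j : ℕ} {s t : ℝ} (heq : cell b j s = cell b j t)
    (hne : cell b (j + 1) s ≠ cell b (j + 1) t) (hjK : j < K) :
    pathCov b K s t =
      (b : ℝ) / ((b : ℝ) - 1) ^ 2 - ((b : ℝ) + 1) / ((b : ℝ) - 1) ^ 2 * ((b : ℝ) ^ j)⁻¹ := by
  have hb1 : (b : ℝ) - 1 ≠ 0 := sub_ne_zero.2 (by exact_mod_cast hb.ne')
  have hb0 : (b : ℝ) ≠ 0 := by positivity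
  induction K, hjK using Nat.le_induction with
  | base =>
    rw [pathCov, Finset.sum_range_succ, ← pathCov, pathCov_of_cell_eq hb heq, innovCov, siblingCov,
      if_pos (by rw [cell_succ_div hb.pos, cell_succ_div hb.pos, heq]), if_neg hne, pow_succ]
    field_simp
    ring
  | succ K hjK ih =>
    have hK : cell b K s ≠ cell b K t := fun h => hne (cell_eq_of_le hb.pos hjK h)
    rw [pathCov, Finset.sum_range_succ, ← pathCov, ih, innovCov, siblingCov,
      if_neg (by rwa [cell_succ_div hb.pos, cell_succ_div hb.pos]), mul_zero, add_zero]

end PathSums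

section Prefixes

/-! ### The covariance function of the limit -/

variable {b : ℕ}

lemma digit_succ (hb : 0 < b) (t : I) (k : ℕ) : digit b t (k + 1) = cell b (k + 1) t % b := by
  unfold digit cell
  have : 0 < b ^ (k + 1) := by positivity
  split_ifs with h
  · subst h
    have hlast : (b ^ (k + 1) - 1) % b = b - 1 := by
      obtain ⟨a, ha⟩ := Nat.exists_eq_add_one_of_ne_zero (pow_pos hb k).ne'
      rw [pow_succ', ha, mul_add_one, Nat.add_sub_assoc hb, Nat.mul_add_mod,
        Nat.mod_eq_of_lt (Nat.sub_one_lt_of_lt hb)]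
    rw [Set.Icc.coe_one, one_mul, ← Nat.cast_pow, Nat.floor_natCast,
      min_eq_right (Nat.sub_le _ _), hlast]
  · have ht : (t : ℝ) < 1 := t.2.2.lt_of_ne fun e => h (Subtype.ext e)
    have hlt : ⌊(t : ℝ) * (b : ℝ) ^ (k + 1)⌋₊ < b ^ (k + 1) := by
      rw [Nat.floor_lt (mul_nonneg t.2.1 (by positivity))]
      push_cast
      exact mul_lt_of_lt_one_left (by positivity) ht
    rw [min_eq_left (Nat.le_sub_one_of_lt hlt)]

lemma forall_digit_eq_iff (hb : 0 < b) (s t : I) (k : ℕ) :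
    (∀ i, 1 ≤ i → i ≤ k → digit b s i = digit b t i) ↔ cell b k s = cell b k t := by
  induction k with
  | zero =>
    simp only [cell_zero, iff_true]
    intro i h1 h2
    omega
  | succ k ih =>
    constructor
    · intro h
      rw [← mul_cell_add_mod hb, ← mul_cell_add_mod hb k t,
        ih.1 fun i h1 h2 => h i h1 (h2.trans k.le_succ), ← digit_succ hb, ← digit_succ hb,
        h (k + 1) k.succ_pos le_rfl]
    · intro h i h1 h2
      rcases h2.lt_or_eq with h2 | rfl
      · exact ih.2 (cell_eq_of_le hb k.le_succ h) i h1 (Nat.le_of_lt_succ h2)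
      · rw [digit_succ hb, digit_succ hb, h]

lemma natCast_le_prefixLength_iff (hb : 0 < b) {s t : I} {k : ℕ} :
    (k : ℕ∞) ≤ prefixLength b s t ↔ cell b k s = cell b k t := by
  simp_rw [prefixLength, forall_digit_eq_iff hb]
  refine ⟨fun h => ?_, fun h => le_iSup₂_of_le k h le_rfl⟩
  by_contra hne
  obtain ⟨k, rfl⟩ : ∃ l, k = l + 1 :=
    Nat.exists_eq_add_one_of_ne_zero fun h0 => hne (by rw [h0, cell_zero, cell_zero])
  have hle : ⨆ (l : ℕ) (_ : cell b l s = cell b l t), (l : ℕ∞) ≤ k :=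
    iSup₂_le fun l hl => Nat.cast_le.2 <| Nat.le_of_lt_succ <| not_le.1 fun hkl =>
      hne (cell_eq_of_le hb hkl hl)
  exact absurd (Nat.cast_le.1 (h.trans hle)) k.not_succ_le_self

/-- The covariance function of the limit. -/
def limCov (b : ℕ) (s t : I) : ℝ :=
  (b : ℝ) / ((b : ℝ) - 1) ^ 2 - ((b : ℝ) + 1) / ((b : ℝ) - 1) ^ 2 * negPow b (prefixLength b s t)

lemma limCov_comm (b : ℕ) (s t : I) : limCov b s t = limCov b t s := by
  simp only [limCov, prefixLength, eq_comm]

lemma tendsto_pathCov (hb : 1 < b) (s t : I) :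
    Tendsto (fun K => pathCov b K s t) atTop (𝓝 (limCov b s t)) := by
  by_cases htop : prefixLength b s t = ⊤
  · have hcell (k : ℕ) : cell b k s = cell b k t :=
      (natCast_le_prefixLength_iff hb.pos).1 (htop ▸ le_top)
    have hpow : Tendsto (fun K : ℕ => ((b : ℝ) ^ K)⁻¹) atTop (𝓝 0) :=
      (tendsto_pow_atTop_atTop_of_one_lt (by exact_mod_cast hb)).inv_tendsto_atTop
    simp_rw [pathCov_of_cell_eq hb (hcell _)]
    simpa [limCov, htop, negPow] using (hpow.const_sub 1).const_mul ((b : ℝ) / ((b : ℝ) - 1) ^ 2)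
  · obtain ⟨j, h⟩ := ENat.ne_top_iff_exists.1 htop
    have hcell (k : ℕ) : cell b k s = cell b k t ↔ k ≤ j := by
      rw [← natCast_le_prefixLength_iff hb.pos, ← h, Nat.cast_le]
    refine tendsto_const_nhds.congr' ?_
    filter_upwards [eventually_gt_atTop j] with K hK
    rw [pathCov_of_cell_ne hb ((hcell j).2 le_rfl) ((hcell (j + 1)).not.2 j.not_succ_le_self) hK,
      limCov, negPow, ← h, if_neg (ENat.natCast_ne_top j), ENat.toNat_natCast]

end Prefixes

section SecondMoments

/-! ### Second moments of path sums -/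

variable {b : ℕ} {Ω : Type*} [MeasurableSpace Ω] {P : Measure Ω}

lemma integral_sum_mul_sum {ι κ : Type*} {s : Finset ι} {t : Finset κ} {f : ι → Ω → ℝ}
    {g : κ → Ω → ℝ} (hf : ∀ i ∈ s, MemLp (f i) 2 P) (hg : ∀ j ∈ t, MemLp (g j) 2 P) :
    ∫ ω, (∑ i ∈ s, f i ω) * ∑ j ∈ t, g j ω ∂P = ∑ i ∈ s, ∑ j ∈ t, ∫ ω, f i ω * g j ω ∂P := by
  have hint : ∀ i ∈ s, ∀ j ∈ t, Integrable (fun ω => f i ω * g j ω) P :=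
    fun i hi j hj => (hf i hi).integrable_mul (hg j hj)
  simp_rw [Finset.sum_mul_sum]
  rw [integral_finsetSum _ fun i hi => integrable_finsetSum _ (hint i hi)]
  exact Finset.sum_congr rfl fun i hi => integral_finsetSum _ (hint i hi)

lemma memLp_pathSum {ξ : ℕ → ℕ → Ω → ℝ} (hξ : ∀ m i, MemLp (ξ m i) 2 P) (K : ℕ) (t : ℝ) :
    MemLp (fun ω => pathSum b K (fun m i => ξ m i ω) t) 2 P :=
  memLp_finsetSum _ fun _ _ => hξ _ _

lemma integral_pathSum_mul_pathSum {ξ : ℕ → ℕ → Ω → ℝ} (hξ : ∀ m i, MemLp (ξ m i) 2 P)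
    (hcov : ∀ m l i j, i < b ^ (m + 1) → j < b ^ (l + 1) →
      ∫ ω, ξ (m + 1) i ω * ξ (l + 1) j ω ∂P = if m = l then innovCov b (m + 1) i j else 0)
    (hb : 0 < b) (K : ℕ) (s t : ℝ) :
    ∫ ω, pathSum b K (fun m i => ξ m i ω) s * pathSum b K (fun m i => ξ m i ω) t ∂P =
      pathCov b K s t := by
  simp only [pathSum, integral_sum_mul_sum (fun _ _ => hξ _ _) fun _ _ => hξ _ _,
    hcov _ _ _ _ (cell_lt hb _ _) (cell_lt hb _ _), Finset.sum_ite_eq, pathCov]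
  exact Finset.sum_congr rfl fun m hm => if_pos hm

lemma integral_sq_sum_mul_pathSum {ξ : ℕ → ℕ → Ω → ℝ} (hξ : ∀ m i, MemLp (ξ m i) 2 P)
    (hcov : ∀ m l i j, i < b ^ (m + 1) → j < b ^ (l + 1) →
      ∫ ω, ξ (m + 1) i ω * ξ (l + 1) j ω ∂P = if m = l then innovCov b (m + 1) i j else 0)
    (hb : 0 < b) (K : ℕ) {ι : Type*} (s : Finset ι) (c τ : ι → ℝ) :
    ∫ ω, (∑ v ∈ s, c v * pathSum b K (fun m i => ξ m i ω) (τ v)) ^ 2 ∂P =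
      ∑ v ∈ s, ∑ w ∈ s, c v * c w * pathCov b K (τ v) (τ w) := by
  have hL (v : ι) : MemLp (fun ω => c v * pathSum b K (fun m i => ξ m i ω) (τ v)) 2 P :=
    (memLp_pathSum hξ K _).const_mul _
  simp_rw [sq, integral_sum_mul_sum (fun v _ => hL v) fun v _ => hL v, mul_mul_mul_comm (c _),
    integral_const_mul, integral_pathSum_mul_pathSum hξ hcov hb]

end SecondMoments

section Noise

/-! ### Gaussian innovations -/

/-- The law of a family of independent standard Gaussian random variables, indexed by level and
number of the cell. -/
def noise : Measure (ℕ × ℕ → ℝ) := Measure.infinitePi fun _ => gaussianReal 0 1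

instance : IsProbabilityMeasure noise := by unfold noise; infer_instance

lemma noise_map_eval (p : ℕ × ℕ) : noise.map (fun ω => ω p) = gaussianReal 0 1 :=
  Measure.infinitePi_map_eval _ p

lemma iIndepFun_noise : iIndepFun (fun (p : ℕ × ℕ) (ω : ℕ × ℕ → ℝ) => ω p) noise :=
  iIndepFun_infinitePi (X := fun _ x => x) fun _ => measurable_id

lemma hasGaussianLaw_eval (p : ℕ × ℕ) : HasGaussianLaw (fun ω : ℕ × ℕ → ℝ => ω p) noise :=
  ⟨by rw [noise_map_eval]; infer_instance⟩

lemma memLp_eval (p : ℕ × ℕ) : MemLp (fun ω : ℕ × ℕ → ℝ => ω p) 2 noise :=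
  (hasGaussianLaw_eval p).memLp (by simp)

lemma integral_comp_eval {f : ℝ → ℝ} (hf : Continuous f) (p : ℕ × ℕ) :
    ∫ ω, f (ω p) ∂noise = ∫ x, f x ∂gaussianReal 0 1 := by
  rw [← noise_map_eval p,
    integral_map (measurable_pi_apply p).aemeasurable hf.aestronglyMeasurable]

lemma integral_eval (p : ℕ × ℕ) : ∫ ω, ω p ∂noise = 0 :=
  (integral_comp_eval continuous_id p).trans integral_id_gaussianReal

lemma integral_sq_gaussianReal (v : NNReal) : ∫ x, x ^ 2 ∂gaussianReal 0 v = v := by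
  rw [← variance_fun_id_gaussianReal (μ := 0) (v := v),
    variance_of_integral_eq_zero measurable_id'.aemeasurable integral_id_gaussianReal]

lemma integral_eval_mul_eval (p q : ℕ × ℕ) :
    ∫ ω, ω p * ω q ∂noise = if p = q then 1 else 0 := by
  split_ifs with h
  · subst h
    simp_rw [← sq]
    rw [integral_comp_eval (continuous_pow 2), integral_sq_gaussianReal, NNReal.coe_one]
  · rw [(iIndepFun_noise.indepFun h).integral_fun_mul_eq_mul_integral
      (memLp_eval p).aestronglyMeasurable (memLp_eval q).aestronglyMeasurable, integral_eval,
      zero_mul]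

/-- The linear combinations of the coordinates. -/
def linComb : Submodule ℝ ((ℕ × ℕ → ℝ) → ℝ) := Submodule.span ℝ (Set.range fun p ω => ω p)

lemma eval_mem_linComb (p : ℕ × ℕ) : (fun ω : ℕ × ℕ → ℝ => ω p) ∈ linComb :=
  Submodule.subset_span ⟨p, rfl⟩

lemma sum_mul_mem_linComb {ι : Type*} {s : Finset ι} (c : ι → ℝ) {f : ι → (ℕ × ℕ → ℝ) → ℝ}
    (hf : ∀ i ∈ s, f i ∈ linComb) : (fun ω => ∑ i ∈ s, c i * f i ω) ∈ linComb := by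
  convert linComb.sum_mem fun i hi => linComb.smul_mem (c i) (hf i hi)
  simp

lemma hasGaussianLaw_of_mem_linComb {f : (ℕ × ℕ → ℝ) → ℝ} (hf : f ∈ linComb) :
    HasGaussianLaw f noise := by
  obtain ⟨a, rfl⟩ := Finsupp.mem_span_range_iff_exists_finsupp.1 hf
  have h := iIndepFun.hasGaussianLaw (X := fun (p : a.support) (ω : ℕ × ℕ → ℝ) => ω p)
    (fun p => hasGaussianLaw_eval p) (iIndepFun_noise.precomp Subtype.val_injective)
  convert! h.map (∑ p : a.support, a p • ContinuousLinearMap.proj p) using 1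
  ext ω
  simp [Finsupp.sum, ← Finset.sum_coe_sort a.support]

lemma measurable_of_mem_linComb {f : (ℕ × ℕ → ℝ) → ℝ} (hf : f ∈ linComb) : Measurable f := by
  induction hf using Submodule.span_induction with
  | mem f h => obtain ⟨p, rfl⟩ := h; exact measurable_pi_apply p
  | zero => exact measurable_const
  | add f g _ _ hf hg => exact hf.add hg
  | smul c f _ hf => exact hf.const_smul c

lemma memLp_of_mem_linComb {f : (ℕ × ℕ → ℝ) → ℝ} (hf : f ∈ linComb) : MemLp f 2 noise :=
  (hasGaussianLaw_of_mem_linComb hf).memLp (by simp)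

lemma integrable_mul_of_mem_linComb {f g : (ℕ × ℕ → ℝ) → ℝ} (hf : f ∈ linComb)
    (hg : g ∈ linComb) : Integrable (fun ω => f ω * g ω) noise :=
  (memLp_of_mem_linComb hf).integrable_mul (memLp_of_mem_linComb hg)

lemma integral_of_mem_linComb {f : (ℕ × ℕ → ℝ) → ℝ} (hf : f ∈ linComb) :
    ∫ ω, f ω ∂noise = 0 := by
  induction hf using Submodule.span_induction with
  | mem f h => obtain ⟨p, rfl⟩ := h; exact integral_eval p
  | zero => simp
  | add f g hf hg h1 h2 =>
    rw [integral_add' ((memLp_of_mem_linComb hf).integrable one_le_two)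
      ((memLp_of_mem_linComb hg).integrable one_le_two), h1, h2, add_zero]
  | smul c f _ h => simp [integral_const_mul, h]

lemma map_of_mem_linComb {f : (ℕ × ℕ → ℝ) → ℝ} (hf : f ∈ linComb) :
    noise.map f = gaussianReal 0 (∫ ω, f ω ^ 2 ∂noise).toNNReal := by
  rw [(hasGaussianLaw_of_mem_linComb hf).map_eq_gaussianReal, integral_of_mem_linComb hf,
    variance_of_integral_eq_zero (measurable_of_mem_linComb hf).aemeasurable
      (integral_of_mem_linComb hf)]

/-- The average of the noise over the children of cell `q`, which have level `m`. -/
def noiseAvg (b m q : ℕ) (ω : ℕ × ℕ → ℝ) : ℝ :=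
  ∑ r ∈ Finset.range b, (b : ℝ)⁻¹ * ω (m, b * q + r)

/-- The deviation of the noise in cell `i` of level `m` from the average over its siblings. -/
def noiseDev (b m i : ℕ) (ω : ℕ × ℕ → ℝ) : ℝ := ω (m, i) - noiseAvg b m (i / b) ω

/-- The innovation of the limiting process in cell `i` of level `m`. -/
def innov (b m i : ℕ) (ω : ℕ × ℕ → ℝ) : ℝ :=
  (b : ℝ) / ((b : ℝ) - 1) * (√((b : ℝ) ^ m))⁻¹ * noiseDev b m i ω

lemma noiseAvg_mem_linComb (b m q : ℕ) : noiseAvg b m q ∈ linComb :=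
  sum_mul_mem_linComb _ fun _ _ => eval_mem_linComb _

lemma noiseDev_mem_linComb (b m i : ℕ) : noiseDev b m i ∈ linComb :=
  linComb.sub_mem (eval_mem_linComb _) (noiseAvg_mem_linComb b m (i / b))

lemma innov_mem_linComb (b m i : ℕ) : innov b m i ∈ linComb :=
  linComb.smul_mem _ (noiseDev_mem_linComb b m i)

lemma measurable_innov (b m i : ℕ) : Measurable (innov b m i) :=
  measurable_of_mem_linComb (innov_mem_linComb b m i)

lemma memLp_innov (b m i : ℕ) : MemLp (innov b m i) 2 noise :=
  memLp_of_mem_linComb (innov_mem_linComb b m i)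

lemma integral_noiseAvg_mul {f : (ℕ × ℕ → ℝ) → ℝ} (hf : f ∈ linComb) (b m q : ℕ) :
    ∫ ω, noiseAvg b m q ω * f ω ∂noise =
      ∑ r ∈ Finset.range b, (b : ℝ)⁻¹ * ∫ ω, ω (m, b * q + r) * f ω ∂noise := by
  simp_rw [noiseAvg, Finset.sum_mul, mul_assoc]
  rw [integral_finsetSum _ fun r _ =>
    (integrable_mul_of_mem_linComb (eval_mem_linComb _) hf).const_mul _]
  simp_rw [integral_const_mul]

variable {b : ℕ}

lemma sum_range_ite_mul_add_eq (hb : 0 < b) (q i : ℕ) (a : ℝ) :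
    ∑ r ∈ Finset.range b, (if b * q + r = i then a else 0) = if i / b = q then a else 0 := by
  have hiff : ∀ r ∈ Finset.range b, (b * q + r = i ↔ i % b = r ∧ i / b = q) := fun r hr => by
    rw [and_comm, Nat.div_mod_unique hb, add_comm]
    simpa using fun _ => Finset.mem_range.1 hr
  rw [Finset.sum_congr rfl fun r hr => if_congr (hiff r hr) rfl rfl]
  simp_rw [ite_and, Finset.sum_ite_eq, Finset.mem_range, Nat.mod_lt i hb, if_true]

lemma integral_eval_mul_noiseDev (hb : 0 < b) (m l i j : ℕ) :
    ∫ ω, ω (m, i) * noiseDev b l j ω ∂noise = if m = l then siblingCov b i j else 0 := by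
  have havg : ∫ ω, noiseAvg b l (j / b) ω * ω (m, i) ∂noise =
      if m = l then if i / b = j / b then (b : ℝ)⁻¹ else 0 else 0 := by
    rw [integral_noiseAvg_mul (eval_mem_linComb _)]
    simp_rw [integral_eval_mul_eval, Prod.mk.injEq, ite_and, ← Finset.mul_sum, eq_comm (a := l)]
    split_ifs <;> simp_all [sum_range_ite_mul_add_eq hb]
  simp_rw [noiseDev, mul_sub, mul_comm _ (noiseAvg _ _ _ _)]
  rw [integral_sub (integrable_mul_of_mem_linComb (eval_mem_linComb _) (eval_mem_linComb _))
    (integrable_mul_of_mem_linComb (noiseAvg_mem_linComb _ _ _) (eval_mem_linComb _)), havg,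
    integral_eval_mul_eval]
  by_cases hij : i = j <;> simp [siblingCov, hij]
  all_goals split_ifs <;> simp

lemma sum_siblingCov (hb : 0 < b) (q j : ℕ) :
    ∑ r ∈ Finset.range b, siblingCov b (b * q + r) j = 0 := by
  have hdiv : ∀ r ∈ Finset.range b, (b * q + r) / b = q := fun r hr => by
    rw [Nat.mul_add_div hb, Nat.div_eq_of_lt (Finset.mem_range.1 hr), add_zero]
  unfold siblingCov
  rw [Finset.sum_congr rfl fun r hr => by rw [hdiv r hr]]
  split_ifs with h
  · rw [Finset.sum_sub_distrib, sum_range_ite_mul_add_eq hb, if_pos h.symm, Finset.sum_const,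
      Finset.card_range, nsmul_eq_mul, mul_inv_cancel₀ (by positivity), sub_self]
  · exact Finset.sum_const_zero

lemma integral_noiseDev_mul_noiseDev (hb : 0 < b) (m l i j : ℕ) :
    ∫ ω, noiseDev b m i ω * noiseDev b l j ω ∂noise = if m = l then siblingCov b i j else 0 := by
  have havg : ∫ ω, noiseAvg b m (i / b) ω * noiseDev b l j ω ∂noise = 0 := by
    rw [integral_noiseAvg_mul (noiseDev_mem_linComb _ _ _), ← Finset.mul_sum]
    simp_rw [integral_eval_mul_noiseDev hb]
    split_ifs
    · rw [sum_siblingCov hb, mul_zero]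
    · rw [Finset.sum_const_zero, mul_zero]
  rw [← integral_eval_mul_noiseDev hb, ← sub_zero (∫ ω, ω (m, i) * _ ∂noise), ← havg, ← integral_sub
    (integrable_mul_of_mem_linComb (eval_mem_linComb _) (noiseDev_mem_linComb _ _ _))
    (integrable_mul_of_mem_linComb (noiseAvg_mem_linComb _ _ _) (noiseDev_mem_linComb _ _ _))]
  simp_rw [← sub_mul]
  rfl

lemma integral_innov_mul_innov (hb : 0 < b) (m l i j : ℕ) :
    ∫ ω, innov b m i ω * innov b l j ω ∂noise = if m = l then innovCov b m i j else 0 := by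
  simp_rw [innov, mul_mul_mul_comm _ (noiseDev b m i _), integral_const_mul,
    integral_noiseDev_mul_noiseDev hb]
  split_ifs with h
  · have hsq : (√((b : ℝ) ^ m))⁻¹ * (√((b : ℝ) ^ m))⁻¹ = ((b : ℝ) ^ m)⁻¹ := by
      rw [← mul_inv, Real.mul_self_sqrt (by positivity)]
    rw [← h, mul_mul_mul_comm, hsq, ← sq, innovCov]
  · rw [mul_zero]

end Noise

section LevelBound

/-! ### Uniform bounds on one level -/

lemma abs_le_add_pow_four {θ : ℝ} (hθ : 0 < θ) (y : ℝ) : |y| ≤ θ + (θ ^ 3)⁻¹ * y ^ 4 := by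
  rcases le_or_gt |y| θ with h | h
  · exact h.trans (le_add_of_nonneg_right (by positivity))
  · refine le_add_of_nonneg_of_le hθ.le ?_
    rw [inv_mul_eq_div, le_div_iff₀ (by positivity)]
    calc |y| * θ ^ 3 ≤ |y| * |y| ^ 3 := by gcongr
      _ = y ^ 4 := by rw [← pow_succ', (by decide : Even 4).pow_abs]

/-- An upper bound for the absolute values of `z i`, `i < b ^ m`, of small expectation if the
fourth moments are of order `b ^ (-2 * m)`. Any base in `(2 ^ (-1/3), 1)` could replace `4 / 5`. -/
def levelBound (b m : ℕ) (z : ℕ → ℝ) : ℝ :=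
  (4 / 5) ^ m + (((4 / 5) ^ m) ^ 3)⁻¹ * ∑ i ∈ Finset.range (b ^ m), z i ^ 4

lemma levelBound_nonneg (b m : ℕ) (z : ℕ → ℝ) : 0 ≤ levelBound b m z := by
  have : 0 ≤ ∑ i ∈ Finset.range (b ^ m), z i ^ 4 := Finset.sum_nonneg fun i _ => by positivity
  unfold levelBound
  positivity

variable {b : ℕ}

lemma abs_le_levelBound {m i : ℕ} (z : ℕ → ℝ) (hi : i < b ^ m) : |z i| ≤ levelBound b m z := by
  refine (abs_le_add_pow_four (show 0 < (4 / 5 : ℝ) ^ m by positivity) (z i)).trans ?_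
  unfold levelBound
  gcongr
  exact Finset.single_le_sum (f := fun i => z i ^ 4) (fun i _ => by positivity)
    (Finset.mem_range.2 hi)

lemma inv_pow_mul_inv_pow_le (hb : 1 < b) (m : ℕ) :
    (((4 / 5 : ℝ) ^ m) ^ 3)⁻¹ * ((b : ℝ) ^ m)⁻¹ ≤ (125 / 128) ^ m := by
  have hb2 : (2 : ℝ) ≤ b := by exact_mod_cast hb
  rw [← mul_inv, pow_right_comm, ← mul_pow, ← inv_pow]
  refine pow_le_pow_left₀ (by positivity) ?_ m
  rw [inv_le_comm₀ (by positivity) (by positivity)]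
  linarith

variable {Ω : Type*} [MeasurableSpace Ω] {P : Measure Ω} {m : ℕ} {z : ℕ → Ω → ℝ}

lemma integrable_levelBound [IsFiniteMeasure P]
    (hz : ∀ i < b ^ m, Integrable (fun ω => z i ω ^ 4) P) :
    Integrable (fun ω => levelBound b m fun i => z i ω) P :=
  (integrable_const _).add ((integrable_finsetSum _ fun i hi =>
    hz i (Finset.mem_range.1 hi)).const_mul _)

lemma integral_levelBound_le [IsProbabilityMeasure P] (hb : 1 < b) {C : ℝ} (hC : 0 ≤ C)
    (hz : ∀ i < b ^ m, Integrable (fun ω => z i ω ^ 4) P)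
    (hz4 : ∀ i < b ^ m, ∫ ω, z i ω ^ 4 ∂P ≤ C * (((b : ℝ) ^ m)⁻¹) ^ 2) :
    ∫ ω, levelBound b m (fun i => z i ω) ∂P ≤ (1 + C) * (125 / 128) ^ m := by
  have hsum : ∑ i ∈ Finset.range (b ^ m), ∫ ω, z i ω ^ 4 ∂P ≤ C * ((b : ℝ) ^ m)⁻¹ := by
    refine (Finset.sum_le_card_nsmul _ _ _ fun i hi => hz4 i (Finset.mem_range.1 hi)).trans_eq ?_
    rw [Finset.card_range, nsmul_eq_mul, Nat.cast_pow]
    field_simp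
  unfold levelBound
  rw [integral_add (integrable_const _) ((integrable_finsetSum _ fun i hi =>
    hz i (Finset.mem_range.1 hi)).const_mul _), integral_const_mul,
    integral_finsetSum _ fun i hi => hz i (Finset.mem_range.1 hi), integral_const,
    probReal_univ, one_smul, add_mul, one_mul]
  refine add_le_add (pow_le_pow_left₀ (by norm_num) (by norm_num) m) ?_
  calc (((4 / 5 : ℝ) ^ m) ^ 3)⁻¹ * ∑ i ∈ Finset.range (b ^ m), ∫ ω, z i ω ^ 4 ∂P
      ≤ (((4 / 5) ^ m) ^ 3)⁻¹ * (C * ((b : ℝ) ^ m)⁻¹) := by gcongr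
    _ = C * ((((4 / 5) ^ m) ^ 3)⁻¹ * ((b : ℝ) ^ m)⁻¹) := by ring
    _ ≤ C * (125 / 128) ^ m := by gcongr; exact inv_pow_mul_inv_pow_le hb m

lemma integral_pow_four_gaussianReal (v : NNReal) :
    ∫ x, x ^ 4 ∂gaussianReal 0 v = (v : ℝ) ^ 2 * ∫ x, x ^ 4 ∂gaussianReal 0 1 := by
  have hmap : (gaussianReal 0 1).map (√v * ·) = gaussianReal 0 v := by
    rw [gaussianReal_map_const_mul, mul_zero]
    congr 1
    ext
    simp
  rw [← hmap, integral_map (by fun_prop) (by fun_prop)]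
  simp_rw [mul_pow]
  rw [integral_const_mul, pow_mul (√_) 2 2, Real.sq_sqrt v.coe_nonneg]

lemma innovCov_self_nonneg (hb : 1 < b) (m i : ℕ) : 0 ≤ innovCov b m i i := by
  have hb1 : (0 : ℝ) < b - 1 := sub_pos.2 (by exact_mod_cast hb)
  rw [innovCov_self hb]
  positivity

lemma innovCov_self_le (hb : 1 < b) (m i : ℕ) : innovCov b m i i ≤ 2 * ((b : ℝ) ^ m)⁻¹ := by
  have hb2 : (2 : ℝ) ≤ b := by exact_mod_cast hb
  rw [innovCov_self hb]
  gcongr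
  rw [div_le_iff₀ (by linarith)]
  linarith

lemma integrable_innov_pow_four (b m i : ℕ) : Integrable (fun ω => innov b m i ω ^ 4) noise := by
  have hL : MemLp (innov b m i) 4 noise :=
    (hasGaussianLaw_of_mem_linComb (innov_mem_linComb b m i)).memLp (by simp)
  simpa only [Real.norm_eq_abs, (by decide : Even 4).pow_abs] using
    hL.integrable_norm_pow (p := 4) (by norm_num)

lemma integral_innov_pow_four_le (hb : 1 < b) (m i : ℕ) :
    ∫ ω, innov b m i ω ^ 4 ∂noise ≤
      4 * (∫ x, x ^ 4 ∂gaussianReal 0 1) * (((b : ℝ) ^ m)⁻¹) ^ 2 := by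
  have hvar : ∫ ω, innov b m i ω ^ 2 ∂noise = innovCov b m i i := by
    simp_rw [sq]
    rw [integral_innov_mul_innov hb.pos, if_pos rfl]
  have : 0 ≤ ∫ x, x ^ 4 ∂gaussianReal 0 1 := integral_nonneg fun x => by positivity
  have hcov := innovCov_self_nonneg hb m i
  calc ∫ ω, innov b m i ω ^ 4 ∂noise
      = innovCov b m i i ^ 2 * ∫ x, x ^ 4 ∂gaussianReal 0 1 := by
        rw [← Real.coe_toNNReal _ hcov, ← integral_pow_four_gaussianReal, ← hvar,
          ← map_of_mem_linComb (innov_mem_linComb b m i),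
          integral_map (measurable_innov b m i).aemeasurable (by fun_prop)]
    _ ≤ (2 * ((b : ℝ) ^ m)⁻¹) ^ 2 * ∫ x, x ^ 4 ∂gaussianReal 0 1 := by
        gcongr; exact innovCov_self_le hb m i
    _ = _ := by ring

end LevelBound

section Limit

/-! ### The limiting process -/

variable {b : ℕ}

lemma ae_summable_norm_of_summable_integral_norm {Ω E : Type*} [MeasurableSpace Ω]
    [NormedAddCommGroup E] {P : Measure Ω} {f : ℕ → Ω → E} (hf : ∀ n, Integrable (f n) P)
    (h : Summable fun n => ∫ ω, ‖f n ω‖ ∂P) : ∀ᵐ ω ∂P, Summable fun n => ‖f n ω‖ := by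
  refine summable_norm_of_tsum_eLpNorm_ne_top le_rfl (fun n => (hf n).aestronglyMeasurable) ?_
  simp_rw [eLpNorm_one_eq_lintegral_enorm, ← ofReal_integral_norm_eq_lintegral_enorm (hf _)]
  rw [← ENNReal.ofReal_tsum_of_nonneg (fun n => integral_nonneg fun ω => norm_nonneg _) h]
  exact ENNReal.ofReal_ne_top

/-- A bound for the innovations of level `m + 1`. -/
def innovBound (b m : ℕ) (ω : ℕ × ℕ → ℝ) : ℝ := levelBound b (m + 1) fun i => innov b (m + 1) i ω

lemma norm_innov_cell_le (hb : 0 < b) (m : ℕ) (ω : ℕ × ℕ → ℝ) (u : ℝ) :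
    ‖innov b (m + 1) (cell b (m + 1) u) ω‖ ≤ innovBound b m ω :=
  abs_le_levelBound (fun i => innov b (m + 1) i ω) (cell_lt hb _ _)

lemma ae_summable_innovBound (hb : 1 < b) :
    ∀ᵐ ω ∂noise, Summable fun m => innovBound b m ω := by
  have hnorm (m : ℕ) (ω : ℕ × ℕ → ℝ) : ‖innovBound b m ω‖ = innovBound b m ω :=
    Real.norm_of_nonneg (levelBound_nonneg _ _ _)
  have : 0 ≤ ∫ x, x ^ 4 ∂gaussianReal 0 1 := integral_nonneg fun x => by positivity
  have hint (m : ℕ) : Integrable (innovBound b m) noise :=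
    integrable_levelBound fun i _ => integrable_innov_pow_four b (m + 1) i
  have hsum : Summable fun m => ∫ ω, ‖innovBound b m ω‖ ∂noise := by
    refine .of_nonneg_of_le (fun m => integral_nonneg fun ω => norm_nonneg _) (fun m => ?_) <|
      ((summable_nat_add_iff 1).2 (summable_geometric_of_lt_one (r := (125 / 128 : ℝ))
        (by norm_num) (by norm_num))).mul_left (1 + 4 * ∫ x, x ^ 4 ∂gaussianReal 0 1)
    simp_rw [hnorm]
    exact integral_levelBound_le hb (by positivity)
      (fun i _ => integrable_innov_pow_four b (m + 1) i)
      fun i _ => integral_innov_pow_four_le hb (m + 1) i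
  simpa only [hnorm] using ae_summable_norm_of_summable_integral_norm hint hsum

open scoped Classical in
/-- The path of the limiting process: the sum of the innovations along the path of cells that
contain `t`. On the null set where the bounds are not summable it is set to `0`. -/
def limitPath (hb : 0 < b) (ω : ℕ × ℕ → ℝ) : Cadlag :=
  if h : Summable fun m => innovBound b m ω then
    { toFun t := ∑' m, innov b (m + 1) (cell b (m + 1) t) ω
      right_cont t := by
        refine tendsto_tsum_of_dominated_convergence h (fun m => ?_)
          (.of_forall fun s m => norm_innov_cell_le hb m ω s)
        refine tendsto_const_nhds.congr' ?_
        filter_upwards [eventually_cell_eq_nhdsGE b (m + 1) t] with s hs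
        rw [hs]
      left_lim t := by
        choose i hi using fun m => exists_eventually_cell_eq_nhdsLT b (m + 1) t
        refine ⟨∑' m, innov b (m + 1) (i m) ω, tendsto_tsum_of_dominated_convergence h (fun m => ?_)
          (.of_forall fun s m => norm_innov_cell_le hb m ω s)⟩
        refine tendsto_const_nhds.congr' ?_
        filter_upwards [hi m] with s hs
        rw [hs] }
  else stepFun hb 0 0

lemma limitPath_apply (hb : 0 < b) {ω : ℕ × ℕ → ℝ} (h : Summable fun m => innovBound b m ω)
    (t : I) : limitPath hb ω t = ∑' m, innov b (m + 1) (cell b (m + 1) t) ω := by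
  rw [limitPath, dif_pos h]

/-- The approximation of the limiting process that takes only the first `K` levels into account. -/
def limitApprox (hb : 0 < b) (K : ℕ) (ω : ℕ × ℕ → ℝ) : Cadlag :=
  pathStep hb K fun m i => innov b m i ω

lemma abs_limitApprox_sub_limitPath_le (hb : 0 < b) {ω : ℕ × ℕ → ℝ}
    (h : Summable fun m => innovBound b m ω) (K : ℕ) (t : I) :
    |limitApprox hb K ω t - limitPath hb ω t| ≤ ∑' m, innovBound b (m + K) ω := by
  have hs : Summable fun m => innov b (m + 1) (cell b (m + 1) t) ω :=
    .of_norm_bounded h fun m => norm_innov_cell_le hb m ω t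
  rw [limitApprox, pathStep_apply, pathSum, limitPath_apply hb h, ← hs.sum_add_tsum_nat_add K,
    sub_add_cancel_left, abs_neg, ← Real.norm_eq_abs]
  exact tsum_of_norm_bounded ((summable_nat_add_iff K).2 h).hasSum fun m =>
    norm_innov_cell_le hb (m + K) ω t

lemma tendsto_limitApprox (hb : 0 < b) {ω : ℕ × ℕ → ℝ}
    (h : Summable fun m => innovBound b m ω) :
    Tendsto (fun K => limitApprox hb K ω) atTop (𝓝 (limitPath hb ω)) :=
  tendsto_iff_dist_tendsto_zero.2 <| squeeze_zero (fun _ => dist_nonneg)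
    (fun K => dist_le_of_forall_abs_sub_le fun t => abs_limitApprox_sub_limitPath_le hb h K t)
    (tendsto_sum_nat_add fun m => innovBound b m ω)

lemma tendsto_limitApprox_apply (hb : 0 < b) {ω : ℕ × ℕ → ℝ}
    (h : Summable fun m => innovBound b m ω) (t : I) :
    Tendsto (fun K => limitApprox hb K ω t) atTop (𝓝 (limitPath hb ω t)) :=
  tendsto_iff_dist_tendsto_zero.2 <| squeeze_zero (fun _ => dist_nonneg)
    (fun K => abs_limitApprox_sub_limitPath_le hb h K t)
    (tendsto_sum_nat_add fun m => innovBound b m ω)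

lemma pathSum_innov_mem_linComb (b K : ℕ) (t : ℝ) :
    (fun ω => pathSum b K (fun m i => innov b m i ω) t) ∈ linComb := by
  simpa only [one_mul, pathSum] using
    sum_mul_mem_linComb (fun _ => 1) fun m _ => innov_mem_linComb b (m + 1) _

lemma stronglyMeasurable_limitApprox (hb : 0 < b) (K : ℕ) :
    StronglyMeasurable (limitApprox hb K) :=
  (continuous_stepFun hb K).comp_stronglyMeasurable <| Measurable.stronglyMeasurable <|
    measurable_pi_lambda (fun ω i => pathSum b K (fun m i => innov b m i ω) (leftEnd hb K i))
      fun _ => measurable_of_mem_linComb (pathSum_innov_mem_linComb b K _)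

lemma aemeasurable_limitPath (hb : 1 < b) : AEMeasurable (limitPath hb.pos) noise :=
  aemeasurable_of_tendsto_metrizable_ae atTop
    (fun K => (stronglyMeasurable_limitApprox hb.pos K).measurable.aemeasurable)
    ((ae_summable_innovBound hb).mono fun _ h => tendsto_limitApprox hb.pos h)

lemma tendstoInMeasure_limitApprox (hb : 1 < b) :
    TendstoInMeasure noise (limitApprox hb.pos) atTop (limitPath hb.pos) :=
  tendstoInMeasure_of_tendsto_ae
    (fun K => (stronglyMeasurable_limitApprox hb.pos K).aestronglyMeasurable)
    ((ae_summable_innovBound hb).mono fun _ h => tendsto_limitApprox hb.pos h)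

lemma eventually_measureReal_dist_limitApprox_le (hb : 1 < b) {ε : ℝ} (hε : 0 < ε) :
    ∀ᶠ K in atTop, noise.real {ω | ε < dist (limitApprox hb.pos K ω) (limitPath hb.pos ω)} ≤ ε := by
  filter_upwards [(tendstoInMeasure_iff_measureReal_dist.1 (tendstoInMeasure_limitApprox hb) ε
    hε).eventually_le_const hε] with K hK
  exact (measureReal_mono (Set.ofPred_subset_ofPred.2 fun ω hω => hω.le)).trans hK

end Limit

section GaussianLimit

/-! ### The limiting process is Gaussian -/

lemma map_eq_gaussianReal_of_tendsto {Ω : Type*} [MeasurableSpace Ω] {P : Measure Ω}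
    [IsProbabilityMeasure P] {f : ℕ → Ω → ℝ} {g : Ω → ℝ} {v : ℕ → ℝ} {w : ℝ}
    (hf : ∀ K, AEMeasurable (f K) P) (hfg : ∀ᵐ ω ∂P, Tendsto (fun K => f K ω) atTop (𝓝 (g ω)))
    (hmap : ∀ K, P.map (f K) = gaussianReal 0 (v K).toNNReal) (hv : Tendsto v atTop (𝓝 w)) :
    P.map g = gaussianReal 0 w.toNNReal := by
  have hg : AEMeasurable g P := aemeasurable_of_tendsto_metrizable_ae atTop hf hfg
  have : IsProbabilityMeasure (P.map g) := Measure.isProbabilityMeasure_map hg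
  refine Measure.ext_of_charFun (funext fun t => ?_)
  have hchar := ProbabilityMeasure.tendsto_iff_tendsto_charFun.1
    (tendstoInDistribution_of_ae_tendsto hf hg hfg).tendsto t
  refine tendsto_nhds_unique hchar ?_
  simp only [ProbabilityMeasure.coe_mk, hmap, charFun_gaussianReal]
  exact (Continuous.tendsto (by fun_prop : Continuous fun u : NNReal =>
    Complex.exp (t * (0 : ℝ) * Complex.I - (u : ℝ) * t ^ 2 / 2)) _).comp
      ((continuous_real_toNNReal.tendsto w).comp hv)

variable {b : ℕ}

lemma integral_sq_sum_mul_pathSum_innov (hb : 0 < b) {ι : Type*} (s : Finset ι) (c τ : ι → ℝ)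
    (K : ℕ) : ∫ ω, (∑ v ∈ s, c v * pathSum b K (fun m i => innov b m i ω) (τ v)) ^ 2 ∂noise =
      ∑ v ∈ s, ∑ w ∈ s, c v * c w * pathCov b K (τ v) (τ w) :=
  integral_sq_sum_mul_pathSum (memLp_innov b)
    (fun m l i j _ _ => by simp_rw [integral_innov_mul_innov hb, add_left_inj]) hb K s c τ

lemma map_sum_mul_pathSum_innov (b : ℕ) {ι : Type*} (s : Finset ι) (c τ : ι → ℝ) (K : ℕ) :
    noise.map (fun ω => ∑ v ∈ s, c v * pathSum b K (fun m i => innov b m i ω) (τ v)) =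
      gaussianReal 0 (∫ ω, (∑ v ∈ s,
        c v * pathSum b K (fun m i => innov b m i ω) (τ v)) ^ 2 ∂noise).toNNReal :=
  map_of_mem_linComb (sum_mul_mem_linComb c fun v _ => pathSum_innov_mem_linComb b K (τ v))

lemma tendsto_sum_pathCov (hb : 1 < b) {ι : Type*} (s : Finset ι) (c : ι → ℝ) (τ : ι → I) :
    Tendsto (fun K => ∑ v ∈ s, ∑ w ∈ s, c v * c w * pathCov b K (τ v) (τ w)) atTop
      (𝓝 (∑ v ∈ s, ∑ w ∈ s, c v * c w * limCov b (τ v) (τ w))) :=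
  tendsto_finsetSum _ fun v _ => tendsto_finsetSum _ fun w _ =>
    (tendsto_pathCov hb (τ v) (τ w)).const_mul _

lemma aemeasurable_limitPath_apply (hb : 1 < b) (t : I) :
    AEMeasurable (fun ω => limitPath hb.pos ω t) noise := by
  refine aemeasurable_of_tendsto_metrizable_ae atTop (fun K => ?_)
    ((ae_summable_innovBound hb).mono fun _ h => tendsto_limitApprox_apply hb.pos h t)
  simp_rw [limitApprox, pathStep_apply]
  exact (measurable_of_mem_linComb (pathSum_innov_mem_linComb b K t)).aemeasurable

lemma map_sum_limitPath (hb : 1 < b) {ι : Type*} (s : Finset ι) (c : ι → ℝ) (τ : ι → I) :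
    noise.map (fun ω => ∑ v ∈ s, c v * limitPath hb.pos ω (τ v)) =
      gaussianReal 0 (∑ v ∈ s, ∑ w ∈ s, c v * c w * limCov b (τ v) (τ w)).toNNReal := by
  refine map_eq_gaussianReal_of_tendsto
    (f := fun K ω => ∑ v ∈ s, c v * pathSum b K (fun m i => innov b m i ω) (τ v)) (fun K => ?_) ?_
    (fun K => (map_sum_mul_pathSum_innov b s c _ K).trans <| by
      rw [integral_sq_sum_mul_pathSum_innov hb.pos])
    (tendsto_sum_pathCov hb s c τ)
  · exact (measurable_of_mem_linComb (sum_mul_mem_linComb c fun v _ =>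
      pathSum_innov_mem_linComb b K (τ v))).aemeasurable
  · filter_upwards [ae_summable_innovBound hb] with ω hω
    simp_rw [← pathStep_apply hb.pos]
    exact tendsto_finsetSum _ fun v _ => (tendsto_limitApprox_apply hb.pos hω (τ v)).const_mul _

lemma isGaussianProcess_limitPath (hb : 1 < b) :
    IsGaussianProcess (fun (t : I) ω => limitPath hb.pos ω t) noise where
  hasGaussianLaw s := by
    have hm : AEMeasurable (fun ω => s.restrict fun t => limitPath hb.pos ω t) noise :=
      aemeasurable_pi_lambda _ fun t => aemeasurable_limitPath_apply hb t
    refine ⟨isGaussian_of_map_eq_gaussianReal fun L => ⟨0, (∑ v : s, ∑ w : s,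
      L (Pi.single v 1) * L (Pi.single w 1) * limCov b (v : I) (w : I)).toNNReal, ?_⟩⟩
    rw [AEMeasurable.map_map_of_aemeasurable (by fun_prop) hm,
      ← map_sum_limitPath hb Finset.univ (fun v : s => L (Pi.single v 1)) fun v => v]
    congr 1
    ext ω
    refine (L.toLinearMap.pi_apply_eq_sum_univ _).trans (Finset.sum_congr rfl fun v _ => ?_)
    have hv : (fun j : s => if v = j then (1 : ℝ) else 0) = Pi.single v 1 := by
      ext w
      simp [Pi.single_apply, eq_comm]
    rw [smul_eq_mul, mul_comm, hv]
    rfl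

lemma integral_limitPath (hb : 1 < b) (t : I) : ∫ ω, limitPath hb.pos ω t ∂noise = 0 := by
  have h := map_sum_limitPath hb {()} (fun _ => 1) fun _ => t
  simp only [Finset.sum_singleton, one_mul] at h
  rw [← integral_map (aemeasurable_limitPath_apply hb t) (f := fun x : ℝ => x) (by fun_prop), h,
    integral_id_gaussianReal]

lemma memLp_limitPath (hb : 1 < b) (t : I) : MemLp (fun ω => limitPath hb.pos ω t) 2 noise :=
  ((isGaussianProcess_limitPath hb).hasGaussianLaw_eval t).memLp (by simp)

lemma integral_sq_sum_limitPath (hb : 1 < b) {ι : Type*} (s : Finset ι) (c : ι → ℝ) (τ : ι → I) :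
    ∫ ω, (∑ v ∈ s, c v * limitPath hb.pos ω (τ v)) ^ 2 ∂noise =
      ∑ v ∈ s, ∑ w ∈ s, c v * c w * limCov b (τ v) (τ w) := by
  have hm : AEMeasurable (fun ω => ∑ v ∈ s, c v * limitPath hb.pos ω (τ v)) noise :=
    Finset.aemeasurable_fun_sum _ fun v _ => (aemeasurable_limitPath_apply hb _).const_mul _
  rw [← integral_map hm (f := fun x : ℝ => x ^ 2) (by fun_prop), map_sum_limitPath hb,
    integral_sq_gaussianReal, Real.coe_toNNReal]
  refine ge_of_tendsto' (tendsto_sum_pathCov hb s c τ) fun K => ?_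
  rw [← integral_sq_sum_mul_pathSum_innov hb.pos]
  exact integral_nonneg fun ω => sq_nonneg _

lemma integral_limitPath_mul_limitPath (hb : 1 < b) (s t : I) :
    ∫ ω, limitPath hb.pos ω s * limitPath hb.pos ω t ∂noise = limCov b s t := by
  -- polarization
  have hadd := integral_sq_sum_limitPath hb Finset.univ (fun _ : Bool => 1) fun i => cond i s t
  have hs := integral_sq_sum_limitPath hb {()} (fun _ => 1) fun _ => s
  have ht := integral_sq_sum_limitPath hb {()} (fun _ => 1) fun _ => t
  simp only [Fintype.sum_bool, Finset.sum_singleton, one_mul, cond_true, cond_false]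
    at hadd hs ht
  have is := (memLp_limitPath hb s).integrable_sq
  have it := (memLp_limitPath hb t).integrable_sq
  have ist : Integrable (fun ω => 2 * (limitPath hb.pos ω s * limitPath hb.pos ω t)) noise :=
    ((memLp_limitPath hb s).integrable_mul (memLp_limitPath hb t)).const_mul 2
  have isst : Integrable (fun ω => limitPath hb.pos ω s ^ 2 +
      2 * (limitPath hb.pos ω s * limitPath hb.pos ω t)) noise := is.add ist
  simp_rw [add_sq, mul_assoc] at hadd
  rw [integral_add isst it, integral_add is ist, integral_const_mul, hs, ht,
    limCov_comm b t s] at hadd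
  linarith

end GaussianLimit

section CellIndicator

/-! ### Uniformly distributed data -/

variable {b : ℕ}

/-- The uniform distribution on `[0,1]`. -/
def unif : Measure ℝ := volume.restrict (Set.Icc 0 1)

instance : IsProbabilityMeasure unif := ⟨by simp [unif]⟩

lemma measurable_cell (b k : ℕ) : Measurable (cell b k) :=
  (Nat.measurable_floor.comp (measurable_id.mul_const _)).min measurable_const

lemma cell_eq_iff_mem_Ico {k i : ℕ} (hi : i < b ^ k) {u : ℝ} (hu : u ∈ Set.Ico 0 1) :
    cell b k u = i ↔ u ∈ Set.Ico (i / (b : ℝ) ^ k) ((i + 1) / (b : ℝ) ^ k) := by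
  have hp : (0 : ℝ) < (b : ℝ) ^ k := by exact_mod_cast (Nat.zero_le i).trans_lt hi
  have hlt : ⌊u * (b : ℝ) ^ k⌋₊ < b ^ k := by
    rw [Nat.floor_lt (mul_nonneg hu.1 hp.le), Nat.cast_pow]
    exact mul_lt_of_lt_one_left hp hu.2
  rw [cell, min_eq_left (Nat.le_sub_one_of_lt hlt), Nat.floor_eq_iff (mul_nonneg hu.1 hp.le),
    Set.mem_Ico, div_le_iff₀ hp, lt_div_iff₀ hp]

lemma unif_cell {k i : ℕ} (hi : i < b ^ k) :
    unif.real {u | cell b k u = i} = ((b : ℝ) ^ k)⁻¹ := by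
  have hp : (0 : ℝ) < (b : ℝ) ^ k := by exact_mod_cast (Nat.zero_le i).trans_lt hi
  have hi' : (i : ℝ) + 1 ≤ (b : ℝ) ^ k := by exact_mod_cast hi
  have hsub : Set.Ico (i / (b : ℝ) ^ k) ((i + 1) / (b : ℝ) ^ k) ⊆ Set.Icc 0 1 := fun u hu =>
    ⟨le_trans (by positivity) hu.1, hu.2.le.trans ((div_le_one hp).2 hi')⟩
  have hae : {u | cell b k u = i} =ᵐ[unif] Set.Ico (i / (b : ℝ) ^ k) ((i + 1) / (b : ℝ) ^ k) := by
    filter_upwards [ae_restrict_mem measurableSet_Icc, ae_restrict_of_ae (volume.ae_ne 1)]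
      with u hu hu1
    exact propext (cell_eq_iff_mem_Ico hi ⟨hu.1, hu.2.lt_of_ne hu1⟩)
  rw [measureReal_congr hae, unif, measureReal_restrict_apply measurableSet_Ico,
    Set.inter_eq_left.2 hsub, Real.volume_real_Ico_of_le (by gcongr; linarith), ← sub_div,
    add_sub_cancel_left, one_div]

/-- The indicator function of cell `i` of level `k`. -/
def cellInd (b k i : ℕ) (u : ℝ) : ℝ := if cell b k u = i then 1 else 0

lemma measurable_cellInd (b k i : ℕ) : Measurable (cellInd b k i) :=
  (measurable_from_top (f := fun a : ℕ => if a = i then (1 : ℝ) else 0)).comp (measurable_cell b k)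

lemma cellInd_mem_Icc (b k i : ℕ) (u : ℝ) : cellInd b k i u ∈ Set.Icc 0 1 := by
  unfold cellInd
  split_ifs <;> simp

lemma memLp_cellInd (b k i : ℕ) (p : ENNReal) : MemLp (cellInd b k i) p unif :=
  .of_bound (measurable_cellInd b k i).aestronglyMeasurable 1 <| .of_forall fun u => by
    rw [Real.norm_of_nonneg (cellInd_mem_Icc _ _ _ _).1]
    exact (cellInd_mem_Icc _ _ _ _).2

lemma integral_cellInd {k i : ℕ} (hi : i < b ^ k) :
    ∫ u, cellInd b k i u ∂unif = ((b : ℝ) ^ k)⁻¹ := by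
  have hs : MeasurableSet {u | cell b k u = i} := measurable_cell b k (measurableSet_singleton i)
  have hind : cellInd b k i = {u | cell b k u = i}.indicator fun _ => (1 : ℝ) := by
    ext u
    simp only [cellInd, Set.indicator, Set.mem_ofPred_eq]
  rw [hind, integral_indicator_const _ hs, unif_cell hi, smul_eq_mul, mul_one]

lemma cellInd_mul_cellInd (hb : 0 < b) (k d p q : ℕ) (u : ℝ) :
    cellInd b k p u * cellInd b (k + d) q u =
      (if q / b ^ d = p then 1 else 0) * cellInd b (k + d) q u := by
  unfold cellInd
  rw [← cell_div_pow hb k d u]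
  by_cases hq : cell b (k + d) u = q
  · rw [hq]
  · rw [if_neg hq, mul_zero, mul_zero]

lemma integral_cellInd_mul_cellInd (hb : 0 < b) (k d p : ℕ) {q : ℕ} (hq : q < b ^ (k + d)) :
    ∫ u, cellInd b k p u * cellInd b (k + d) q u ∂unif =
      (if q / b ^ d = p then 1 else 0) * ((b : ℝ) ^ (k + d))⁻¹ := by
  simp_rw [cellInd_mul_cellInd hb]
  rw [integral_const_mul, integral_cellInd hq]

end CellIndicator

section DataInnov

variable {b : ℕ}

/-- The contribution of a datum to the innovation in cell `i` of level `m`, where `m` is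
positive. -/
def dataInnov (b m i : ℕ) (u : ℝ) : ℝ :=
  (b : ℝ) / ((b : ℝ) - 1) * (cellInd b m i u - (b : ℝ)⁻¹ * cellInd b (m - 1) (i / b) u)

lemma memLp_dataInnov (b m i : ℕ) : MemLp (dataInnov b m i) 2 unif :=
  ((memLp_cellInd b m i 2).sub ((memLp_cellInd b (m - 1) (i / b) 2).const_mul _)).const_mul _

lemma integral_dataInnov_mul {g : ℝ → ℝ} (hg : MemLp g 2 unif) (b m i : ℕ) :
    ∫ u, dataInnov b (m + 1) i u * g u ∂unif = (b : ℝ) / ((b : ℝ) - 1) *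
      (∫ u, cellInd b (m + 1) i u * g u ∂unif -
        (b : ℝ)⁻¹ * ∫ u, cellInd b m (i / b) u * g u ∂unif) := by
  have hmul (k p : ℕ) : Integrable (fun u => cellInd b k p u * g u) unif :=
    (memLp_cellInd b k p 2).integrable_mul hg
  simp_rw [dataInnov, Nat.add_sub_cancel, mul_assoc, sub_mul, mul_assoc]
  rw [integral_const_mul, integral_sub (hmul _ _) ((hmul _ _).const_mul _), integral_const_mul]

lemma integral_cellInd_mul_dataInnov (hb : 0 < b) {k l : ℕ} (hkl : k ≤ l) (p : ℕ) {j : ℕ}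
    (hj : j < b ^ (l + 1)) : ∫ u, cellInd b k p u * dataInnov b (l + 1) j u ∂unif = 0 := by
  obtain ⟨d, rfl⟩ := Nat.exists_eq_add_of_le hkl
  have hj' : j / b < b ^ (k + d) := Nat.div_lt_of_lt_mul (by rwa [← pow_succ'])
  simp_rw [mul_comm (cellInd b k p _)]
  rw [integral_dataInnov_mul (memLp_cellInd b k p 2)]
  simp_rw [mul_comm _ (cellInd b k p _)]
  rw [add_assoc k d 1, integral_cellInd_mul_cellInd hb k (d + 1) p hj,
    integral_cellInd_mul_cellInd hb k d p hj',
    Nat.div_div_eq_div_mul, ← pow_succ', ← add_assoc, pow_succ (b : ℝ), mul_inv]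
  ring

lemma integral_dataInnov (hb : 0 < b) (m : ℕ) {i : ℕ} (hi : i < b ^ (m + 1)) :
    ∫ u, dataInnov b (m + 1) i u ∂unif = 0 := by
  simpa only [cellInd, cell_zero, if_true, one_mul] using
    integral_cellInd_mul_dataInnov hb (Nat.zero_le m) 0 hi

lemma integral_dataInnov_mul_dataInnov_of_lt (hb : 0 < b) {m l : ℕ} (hml : m < l) (i : ℕ) {j : ℕ}
    (hj : j < b ^ (l + 1)) : ∫ u, dataInnov b (m + 1) i u * dataInnov b (l + 1) j u ∂unif = 0 := by
  rw [integral_dataInnov_mul (memLp_dataInnov b (l + 1) j),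
    integral_cellInd_mul_dataInnov hb hml i hj, integral_cellInd_mul_dataInnov hb hml.le _ hj,
    mul_zero, sub_zero, mul_zero]

lemma integral_cellInd_mul_dataInnov_succ (hb : 0 < b) {m i : ℕ} (hi : i < b ^ (m + 1)) (j : ℕ) :
    ∫ u, cellInd b (m + 1) i u * dataInnov b (m + 1) j u ∂unif =
      (b : ℝ) / ((b : ℝ) - 1) * (((b : ℝ) ^ (m + 1))⁻¹ * siblingCov b i j) := by
  have hself := integral_cellInd_mul_cellInd hb (m + 1) 0 j hi
  have hparent := integral_cellInd_mul_cellInd hb m 1 (j / b) hi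
  rw [add_zero, pow_zero, Nat.div_one] at hself
  rw [pow_one] at hparent
  simp_rw [mul_comm (cellInd b (m + 1) i _)]
  rw [integral_dataInnov_mul (memLp_cellInd b (m + 1) i 2), hself, hparent, siblingCov]
  by_cases hij : i = j
  · simp only [hij, if_true]
    ring
  · simp only [hij, if_false]
    split_ifs <;> ring

lemma integral_dataInnov_mul_dataInnov (hb : 0 < b) {m l i j : ℕ} (hi : i < b ^ (m + 1))
    (hj : j < b ^ (l + 1)) :
    ∫ u, dataInnov b (m + 1) i u * dataInnov b (l + 1) j u ∂unif =
      if m = l then innovCov b (m + 1) i j else 0 := by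
  rcases lt_trichotomy m l with hml | rfl | hml
  · rw [integral_dataInnov_mul_dataInnov_of_lt hb hml i hj, if_neg hml.ne]
  · rw [integral_dataInnov_mul (memLp_dataInnov b (m + 1) j),
      integral_cellInd_mul_dataInnov_succ hb hi j, integral_cellInd_mul_dataInnov hb le_rfl _ hj,
      if_pos rfl, innovCov]
    ring
  · simp_rw [mul_comm (dataInnov b (m + 1) i _)]
    rw [integral_dataInnov_mul_dataInnov_of_lt hb hml j hi, if_neg hml.ne']

end DataInnov

section CentralLimitTheorem

/-! ### A multivariate central limit theorem -/

lemma tendsto_charFun_map_pow {Ω : Type*} [MeasurableSpace Ω] {P : Measure Ω}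
    [IsProbabilityMeasure P] {h : Ω → ℝ} (hh : MemLp h 2 P) (h0 : ∫ ω, h ω ∂P = 0) :
    Tendsto (fun n : ℕ => charFun (P.map h) (√n)⁻¹ ^ n) atTop
      (𝓝 (charFun (gaussianReal 0 (∫ ω, h ω ^ 2 ∂P).toNNReal) 1)) := by
  have hm := hh.aestronglyMeasurable.aemeasurable
  set v := ∫ ω, h ω ^ 2 ∂P with hv
  have hv0 : 0 ≤ v := integral_nonneg fun ω => sq_nonneg _
  rw [charFun_gaussianReal, Real.coe_toNNReal _ hv0]
  rcases hv0.eq_or_lt with hz | hpos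
  · have hae : h =ᵐ[P] fun _ => 0 := by
      filter_upwards [(integral_eq_zero_iff_of_nonneg (fun ω => sq_nonneg _)
        hh.integrable_sq).1 hz.symm] with ω hω
      exact pow_eq_zero_iff two_ne_zero |>.1 hω
    rw [Measure.map_congr hae, ← hz]
    simp
  · have h1 : P[fun ω => (√v)⁻¹ * h ω] = 0 := by rw [integral_const_mul, h0, mul_zero]
    have h2 : P[(fun ω => (√v)⁻¹ * h ω) ^ 2] = 1 := by
      simp_rw [Pi.pow_apply, mul_pow]
      rw [integral_const_mul, ← hv, inv_pow, Real.sq_sqrt hv0, inv_mul_cancel₀ hpos.ne']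
    have hlim := tendsto_charFun_inv_sqrt_mul_pow (hm.const_mul _) h1 h2 √v
    convert! hlim using 2 with n
    · rw [charFun_map_mul_comp hm, mul_comm, mul_assoc,
        mul_inv_cancel₀ (Real.sqrt_pos.2 hpos).ne', mul_one]
    · rw [neg_div, ← Complex.ofReal_pow √v, Real.sq_sqrt hv0]
      simp

lemma charFun_map_toLp {Ω ι : Type*} [Fintype ι] [MeasurableSpace Ω] {P : Measure Ω}
    {f : Ω → ι → ℝ} (hf : AEMeasurable f P) (c : EuclideanSpace ℝ ι) :
    charFun (P.map fun ω => WithLp.toLp 2 (f ω)) c =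
      charFun (P.map fun ω => ∑ v, c v * f ω v) 1 := by
  have hm : AEMeasurable (fun ω => WithLp.toLp 2 (f ω)) P :=
    (PiLp.continuous_toLp 2 _).measurable.comp_aemeasurable hf
  have hs : AEMeasurable (fun ω => ∑ v, c v * f ω v) P := by fun_prop
  rw [charFun_apply, charFun_apply_real, integral_map hm (by fun_prop),
    integral_map hs (by fun_prop)]
  simp [PiLp.inner_apply]

variable {E : Type*} [MeasurableSpace E] {μ : Measure E} [IsProbabilityMeasure μ]

lemma aemeasurable_inv_sqrt_mul_sum {h : E → ℝ} (hh : AEMeasurable h μ) (n : ℕ) :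
    AEMeasurable (fun x : Fin n → E => (√n)⁻¹ * ∑ j, h (x j)) (Measure.pi fun _ => μ) :=
  (Finset.aemeasurable_fun_sum _ fun j _ => hh.comp_quasiMeasurePreserving
    (Measure.quasiMeasurePreserving_eval _ j)).const_mul _

lemma charFun_map_inv_sqrt_mul_sum {h : E → ℝ} (hh : AEMeasurable h μ) (n : ℕ) :
    charFun ((Measure.pi fun _ => μ).map fun x : Fin n → E => (√n)⁻¹ * ∑ j, h (x j)) 1 =
      charFun (μ.map h) (√n)⁻¹ ^ n := by
  have hexp (x : Fin n → E) : Complex.exp ((1 : ℝ) * ((√n)⁻¹ * ∑ j, h (x j) : ℝ) * Complex.I) =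
      ∏ j, Complex.exp (((√n)⁻¹ : ℝ) * h (x j) * Complex.I) := by
    rw [← Complex.exp_sum, ← Finset.sum_mul, ← Finset.mul_sum]
    push_cast
    rw [one_mul]
  rw [charFun_apply_real, integral_map (aemeasurable_inv_sqrt_mul_sum hh n) (by fun_prop),
    charFun_apply_real, integral_map hh (by fun_prop)]
  simp_rw [hexp]
  rw [integral_fintype_prod_eq_pow (fun u => Complex.exp (((√n)⁻¹ : ℝ) * h u * Complex.I)),
    Fintype.card_fin]

variable {ι Ω : Type*} [Fintype ι] [MeasurableSpace Ω] {P : Measure Ω} [IsProbabilityMeasure P]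
  {f : ι → E → ℝ} {Z : Ω → ι → ℝ}

theorem tendstoInDistribution_inv_sqrt_mul_sum_pi (hf : ∀ v, MemLp (f v) 2 μ)
    (hf0 : ∀ v, ∫ u, f v u ∂μ = 0) (hZ : AEMeasurable Z P)
    (hlaw : ∀ c : ι → ℝ, P.map (fun ω => ∑ v, c v * Z ω v) =
      gaussianReal 0 (∫ u, (∑ v, c v * f v u) ^ 2 ∂μ).toNNReal) :
    TendstoInDistribution (fun n (x : Fin n → E) v => (√n)⁻¹ * ∑ j, f v (x j)) atTop Z
      (fun _ => Measure.pi fun _ => μ) P := by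
  have hcont := PiLp.continuous_toLp 2 fun _ : ι => ℝ
  have hS (n : ℕ) : AEMeasurable (fun (x : Fin n → E) v => (√n)⁻¹ * ∑ j, f v (x j))
      (Measure.pi fun _ => μ) := aemeasurable_pi_lambda _ fun v =>
    aemeasurable_inv_sqrt_mul_sum (hf v).aestronglyMeasurable.aemeasurable n
  have hLp : TendstoInDistribution (fun n (x : Fin n → E) =>
      (WithLp.toLp 2 fun v => (√n)⁻¹ * ∑ j, f v (x j) : EuclideanSpace ℝ ι)) atTop
      (fun ω => WithLp.toLp 2 (Z ω)) (fun _ => Measure.pi fun _ => μ) P :=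
    { forall_aemeasurable n := hcont.measurable.comp_aemeasurable (hS n)
      aemeasurable_limit := hcont.measurable.comp_aemeasurable hZ
      tendsto := ProbabilityMeasure.tendsto_iff_tendsto_charFun.2 fun c => by
        have hc : MemLp (fun u => ∑ v, c v * f v u) 2 μ :=
          memLp_finsetSum _ fun v _ => (hf v).const_mul _
        have hc0 : ∫ u, ∑ v, c v * f v u ∂μ = 0 := by
          rw [integral_finsetSum _ fun v _ => ((hf v).integrable one_le_two).const_mul _]
          simp_rw [integral_const_mul, hf0, mul_zero, Finset.sum_const_zero]
        have hsum (n : ℕ) (x : Fin n → E) : ∑ v, c v * ((√n)⁻¹ * ∑ j, f v (x j)) =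
            (√n)⁻¹ * ∑ j, ∑ v, c v * f v (x j) := by
          simp_rw [Finset.mul_sum]
          rw [Finset.sum_comm]
          simp_rw [mul_left_comm (c _)]
        simp only [ProbabilityMeasure.coe_mk]
        rw [charFun_map_toLp hZ, hlaw]
        simp_rw [fun n => charFun_map_toLp (hS n) c, hsum,
          charFun_map_inv_sqrt_mul_sum hc.aestronglyMeasurable.aemeasurable]
        exact tendsto_charFun_map_pow hc hc0 }
  exact hLp.continuous_comp (PiLp.continuous_ofLp 2 _)

end CentralLimitTheorem

section DataApprox

variable {b : ℕ}

/-- The law of `n` independent data, uniformly distributed on `[0,1]`. -/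
abbrev dataLaw (n : ℕ) : Measure (Fin n → ℝ) := Measure.pi fun _ => unif

/-- The approximation of the normalized process that takes only the first `K` levels into
account. -/
def dataApprox (hb : 0 < b) (K : ℕ) {n : ℕ} (x : Fin n → ℝ) : Cadlag :=
  pathStep hb K fun m i => (√n)⁻¹ * ∑ j, dataInnov b m i (x j)

lemma integral_pathSum_dataInnov (hb : 0 < b) (K : ℕ) (t : ℝ) :
    ∫ u, pathSum b K (fun m i => dataInnov b m i u) t ∂unif = 0 := by
  unfold pathSum
  rw [integral_finsetSum _ fun m _ => (memLp_dataInnov b _ _).integrable one_le_two]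
  exact Finset.sum_eq_zero fun m _ => integral_dataInnov hb m (cell_lt hb _ _)

theorem tendstoInDistribution_dataApprox (hb : 0 < b) (K : ℕ) :
    TendstoInDistribution (fun n (x : Fin n → ℝ) => dataApprox hb K x) atTop (limitApprox hb K)
      dataLaw noise := by
  set τ : Fin (b ^ K) → ℝ := fun v => leftEnd hb K v
  have hlaw (c : Fin (b ^ K) → ℝ) :
      noise.map (fun ω => ∑ v, c v * pathSum b K (fun m i => innov b m i ω) (τ v)) =
        gaussianReal 0 (∫ u,
          (∑ v, c v * pathSum b K (fun m i => dataInnov b m i u) (τ v)) ^ 2 ∂unif).toNNReal := by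
    rw [map_sum_mul_pathSum_innov, integral_sq_sum_mul_pathSum_innov hb,
      integral_sq_sum_mul_pathSum (memLp_dataInnov b)
        (fun m l i j => integral_dataInnov_mul_dataInnov hb) hb]
  have hclt := tendstoInDistribution_inv_sqrt_mul_sum_pi
    (fun v => memLp_pathSum (memLp_dataInnov b) K (τ v))
    (fun v => integral_pathSum_dataInnov hb K (τ v))
    (aemeasurable_pi_lambda _ fun v =>
      (measurable_of_mem_linComb (pathSum_innov_mem_linComb b K (τ v))).aemeasurable) hlaw
  have hdata (n : ℕ) (x : Fin n → ℝ) : dataApprox hb K x = stepFun hb K fun v =>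
      (√n)⁻¹ * ∑ j, pathSum b K (fun m i => dataInnov b m i (x j)) (τ v) := by
    simp_rw [dataApprox, pathStep, pathSum, ← Finset.mul_sum]
    congr! 3
    exact Finset.sum_comm
  simp_rw [hdata]
  exact hclt.continuous_comp (continuous_stepFun hb K)

end DataApprox

section Moments

/-! ### Moments of the occupation numbers -/

variable {Ω : Type*} [MeasurableSpace Ω] {P : Measure Ω} [IsProbabilityMeasure P]

lemma integrable_pow_of_memLp {X : Ω → ℝ} {p : ℕ} (hX : MemLp X p P) {k : ℕ} (hk : k ≤ p) :
    Integrable (fun ω => X ω ^ k) P := by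
  have hXk : MemLp X k P := hX.mono_exponent (by exact_mod_cast hk)
  refine (integrable_norm_iff (hX.aestronglyMeasurable.pow k)).1 ?_
  simpa only [Pi.pow_apply, norm_pow] using hXk.integrable_norm_pow'

lemma integral_add_pow_four_of_indepFun {X Y : Ω → ℝ} (hX : MemLp X 4 P) (hY : MemLp Y 4 P)
    (hXY : IndepFun X Y P) (hX0 : ∫ ω, X ω ∂P = 0) (hY0 : ∫ ω, Y ω ∂P = 0) :
    ∫ ω, (X ω + Y ω) ^ 4 ∂P = ∫ ω, X ω ^ 4 ∂P +
      6 * ((∫ ω, X ω ^ 2 ∂P) * ∫ ω, Y ω ^ 2 ∂P) + ∫ ω, Y ω ^ 4 ∂P := by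
  have hXk {k : ℕ} (hk : k ≤ 4) := integrable_pow_of_memLp hX hk
  have hYk {k : ℕ} (hk : k ≤ 4) := integrable_pow_of_memLp hY hk
  have hindep (k l : ℕ) : IndepFun (fun ω => X ω ^ k) (fun ω => Y ω ^ l) P :=
    hXY.comp (measurable_id.pow_const k) (measurable_id.pow_const l)
  have hint {k l : ℕ} (hk : k ≤ 4) (hl : l ≤ 4) : Integrable (fun ω => X ω ^ k * Y ω ^ l) P :=
    (hindep k l).integrable_mul (hXk hk) (hYk hl)
  have hmul {k l : ℕ} (hk : k ≤ 4) (hl : l ≤ 4) :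
      ∫ ω, X ω ^ k * Y ω ^ l ∂P = (∫ ω, X ω ^ k ∂P) * ∫ ω, Y ω ^ l ∂P :=
    (hindep k l).integral_fun_mul_eq_mul_integral (hXk hk).1 (hYk hl).1
  have h31 : Integrable (fun ω => 4 * (X ω ^ 3 * Y ω ^ 1)) P :=
    (hint (by decide) (by decide)).const_mul _
  have h22 : Integrable (fun ω => 6 * (X ω ^ 2 * Y ω ^ 2)) P :=
    (hint (by decide) (by decide)).const_mul _
  have h13 : Integrable (fun ω => 4 * (X ω ^ 1 * Y ω ^ 3)) P :=
    (hint (by decide) (by decide)).const_mul _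
  have h1 : Integrable (fun ω => X ω ^ 4 + 4 * (X ω ^ 3 * Y ω ^ 1)) P := (hXk le_rfl).add h31
  have h2 : Integrable
      (fun ω => X ω ^ 4 + 4 * (X ω ^ 3 * Y ω ^ 1) + 6 * (X ω ^ 2 * Y ω ^ 2)) P := h1.add h22
  have h3 : Integrable (fun ω => X ω ^ 4 + 4 * (X ω ^ 3 * Y ω ^ 1) + 6 * (X ω ^ 2 * Y ω ^ 2) +
      4 * (X ω ^ 1 * Y ω ^ 3)) P := h2.add h13
  calc ∫ ω, (X ω + Y ω) ^ 4 ∂P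
      = ∫ ω, X ω ^ 4 + 4 * (X ω ^ 3 * Y ω ^ 1) + 6 * (X ω ^ 2 * Y ω ^ 2) +
          4 * (X ω ^ 1 * Y ω ^ 3) + Y ω ^ 4 ∂P := by congr with ω; ring
    _ = _ := by
      rw [integral_add h3 (hYk le_rfl), integral_add h2 h13, integral_add h1 h22,
        integral_add (hXk le_rfl) h31,
        integral_const_mul, integral_const_mul, integral_const_mul,
        hmul (by decide) (by decide), hmul (by decide) (by decide), hmul (by decide) (by decide)]
      simp only [pow_one, hX0, hY0]
      ring

lemma integral_sum_sq_of_iIndepFun {ι : Type*} {η : ι → Ω → ℝ} (hη : ∀ i, MemLp (η i) 2 P)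
    (hind : iIndepFun η P) (h0 : ∀ i, ∫ ω, η i ω ∂P = 0) (s : Finset ι) :
    ∫ ω, (∑ i ∈ s, η i ω) ^ 2 ∂P = ∑ i ∈ s, ∫ ω, η i ω ^ 2 ∂P := by
  have hsum0 : ∫ ω, (∑ i ∈ s, η i) ω ∂P = 0 := by
    simp_rw [Finset.sum_apply]
    rw [integral_finsetSum _ fun i _ => (hη i).integrable one_le_two]
    exact Finset.sum_eq_zero fun i _ => h0 i
  have hvar := IndepFun.variance_sum (s := s) (fun i _ => hη i) fun i _ j _ hij => hind.indepFun hij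
  rw [variance_of_integral_eq_zero (memLp_finsetSum' s fun i _ => hη i).1.aemeasurable
    hsum0] at hvar
  simp_rw [fun i => variance_of_integral_eq_zero (hη i).1.aemeasurable (h0 i)] at hvar
  simpa only [Finset.sum_apply] using hvar

lemma integral_sum_pow_four_le_of_iIndepFun {ι : Type*} {η : ι → Ω → ℝ}
    (hη : ∀ i, MemLp (η i) 4 P) (hind : iIndepFun η P) (h0 : ∀ i, ∫ ω, η i ω ∂P = 0)
    (s : Finset ι) :
    ∫ ω, (∑ i ∈ s, η i ω) ^ 4 ∂P ≤
      ∑ i ∈ s, ∫ ω, η i ω ^ 4 ∂P + 3 * (∑ i ∈ s, ∫ ω, η i ω ^ 2 ∂P) ^ 2 := by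
  classical
  induction s using Finset.induction_on with
  | empty => simp
  | insert a s ha ih =>
    have hsum : MemLp (fun ω => ∑ i ∈ s, η i ω) 4 P := memLp_finsetSum s fun i _ => hη i
    have hsum0 : ∫ ω, ∑ i ∈ s, η i ω ∂P = 0 := by
      rw [integral_finsetSum _ fun i _ => (hη i).integrable (by norm_num)]
      exact Finset.sum_eq_zero fun i _ => h0 i
    have hindep : IndepFun (η a) (fun ω => ∑ i ∈ s, η i ω) P := by
      have h := hind.indepFun_finsetSum_of_notMem₀ (fun i => (hη i).1.aemeasurable) ha
      simpa only [Finset.sum_fn] using h.symm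
    simp_rw [Finset.sum_insert ha]
    rw [integral_add_pow_four_of_indepFun (hη a) hsum hindep (h0 a) hsum0,
      integral_sum_sq_of_iIndepFun (fun i => (hη i).mono_exponent (by norm_num)) hind h0]
    linarith [sq_nonneg (∫ ω, η a ω ^ 2 ∂P)]

lemma integral_pi_sum_pow_four_le {E : Type*} [MeasurableSpace E] {μ : Measure E}
    [IsProbabilityMeasure μ] {h : E → ℝ} (hh : MemLp h 4 μ) (h0 : ∫ u, h u ∂μ = 0) (n : ℕ) :
    ∫ x : Fin n → E, (∑ j, h (x j)) ^ 4 ∂Measure.pi (fun _ => μ) ≤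
      n * ∫ u, h u ^ 4 ∂μ + 3 * (n * ∫ u, h u ^ 2 ∂μ) ^ 2 := by
  have hmp (j : Fin n) := measurePreserving_eval (fun _ : Fin n => μ) j
  have heval (j : Fin n) {g : E → ℝ} (hg : AEStronglyMeasurable g μ) :
      ∫ x : Fin n → E, g (x j) ∂Measure.pi (fun _ => μ) = ∫ u, g u ∂μ :=
    MeasureTheory.integral_comp_eval (μ := fun _ : Fin n => μ) hg
  refine (integral_sum_pow_four_le_of_iIndepFun (fun j => hh.comp_measurePreserving (hmp j))
    (iIndepFun_pi fun _ => hh.1.aemeasurable)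
    (fun j => (heval j hh.1).trans h0) Finset.univ).trans_eq ?_
  have hpow (k : ℕ) (j : Fin n) :
      ∫ x : Fin n → E, h (x j) ^ k ∂Measure.pi (fun _ => μ) = ∫ u, h u ^ k ∂μ :=
    heval j (hh.1.pow k)
  simp [hpow]

variable {b n : ℕ}

lemma count_eq_sum_cellInd (b : ℕ) (x : Fin n → ℝ) (k i : ℕ) :
    (count b x k i : ℝ) = ∑ j, cellInd b k i (x j) := by
  simp [count, cellData, cellInd, Finset.sum_boole]

/-- The normalized deviation of the occupation number of cell `i` of level `k` from its mean. -/
def dev (b k : ℕ) (x : Fin n → ℝ) (i : ℕ) : ℝ := (count b x k i - n * ((b : ℝ) ^ k)⁻¹) / √n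

lemma dev_eq_sum (b k : ℕ) (x : Fin n → ℝ) (i : ℕ) :
    dev b k x i = (√n)⁻¹ * ∑ j, (cellInd b k i (x j) - ((b : ℝ) ^ k)⁻¹) := by
  rw [dev, Finset.sum_sub_distrib, ← count_eq_sum_cellInd, Finset.sum_const, Finset.card_univ,
    Fintype.card_fin, nsmul_eq_mul, div_eq_inv_mul]

lemma memLp_cellInd_sub (b k i : ℕ) (c : ℝ) (p : ENNReal) :
    MemLp (fun u => cellInd b k i u - c) p unif := (memLp_cellInd b k i p).sub (memLp_const c)

lemma integrable_dev_pow_four (b n k i : ℕ) :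
    Integrable (fun x : Fin n → ℝ => dev b k x i ^ 4) (dataLaw n) := by
  simp_rw [dev_eq_sum]
  exact integrable_pow_of_memLp (p := 4) ((memLp_finsetSum _ fun j _ =>
    (memLp_cellInd_sub b k i _ _).comp_measurePreserving
      (measurePreserving_eval (fun _ => unif) j)).const_mul _) le_rfl

lemma integral_cellInd_sub_sq {k i : ℕ} (hi : i < b ^ k) :
    ∫ u, (cellInd b k i u - ((b : ℝ) ^ k)⁻¹) ^ 2 ∂unif =
      ((b : ℝ) ^ k)⁻¹ - (((b : ℝ) ^ k)⁻¹) ^ 2 := by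
  set p := ((b : ℝ) ^ k)⁻¹ with hp
  have hexpand (u : ℝ) :
      (cellInd b k i u - p) ^ 2 = (1 - 2 * p) * cellInd b k i u + p ^ 2 := by
    unfold cellInd
    split_ifs <;> ring
  have hint := (memLp_cellInd b k i 1).integrable le_rfl
  simp_rw [hexpand]
  rw [integral_add (hint.const_mul _) (integrable_const _), integral_const_mul, integral_cellInd hi,
    ← hp, integral_const, probReal_univ, one_smul]
  ring

lemma abs_cellInd_sub_le (b k i : ℕ) (u : ℝ) : |cellInd b k i u - ((b : ℝ) ^ k)⁻¹| ≤ 1 := by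
  have hp : ((b : ℝ) ^ k)⁻¹ ∈ Set.Icc 0 1 := ⟨by positivity, by
    rw [← Nat.cast_pow]; exact Nat.cast_inv_le_one _⟩
  simpa using abs_sub_le_of_le_of_le (cellInd_mem_Icc b k i u).1 (cellInd_mem_Icc b k i u).2
    hp.1 hp.2

lemma integral_cellInd_sub_pow_four_le {k i : ℕ} (hi : i < b ^ k) :
    ∫ u, (cellInd b k i u - ((b : ℝ) ^ k)⁻¹) ^ 4 ∂unif ≤ ((b : ℝ) ^ k)⁻¹ := by
  have hint {l : ℕ} (hl : l ≤ 4) :=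
    integrable_pow_of_memLp (memLp_cellInd_sub b k i ((b : ℝ) ^ k)⁻¹ (4 : ℕ)) hl
  calc ∫ u, (cellInd b k i u - ((b : ℝ) ^ k)⁻¹) ^ 4 ∂unif
      ≤ ∫ u, (cellInd b k i u - ((b : ℝ) ^ k)⁻¹) ^ 2 ∂unif :=
        integral_mono (hint le_rfl) (hint (by decide)) fun u => by
          have h := pow_le_pow_of_le_one (abs_nonneg _) (abs_cellInd_sub_le b k i u)
            (show 2 ≤ 4 by decide)
          rwa [Even.pow_abs (by decide), sq_abs] at h
    _ ≤ ((b : ℝ) ^ k)⁻¹ := by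
        rw [integral_cellInd_sub_sq hi]
        exact sub_le_self _ (sq_nonneg _)

lemma integral_dev_pow_four_le (hn : 0 < n) {k i : ℕ} (hi : i < b ^ k) (hk : b ^ k ≤ b * n) :
    ∫ x, dev b k x i ^ 4 ∂dataLaw n ≤ (b + 3) * (((b : ℝ) ^ k)⁻¹) ^ 2 := by
  have hn' : (0 : ℝ) < n := by exact_mod_cast hn
  have hpos : (0 : ℝ) < (b : ℝ) ^ k := by exact_mod_cast (Nat.zero_le i).trans_lt hi
  have hsqrt : (√(n : ℝ))⁻¹ ^ 4 = ((n : ℝ) ^ 2)⁻¹ := by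
    rw [inv_pow, pow_mul (√(n : ℝ)) 2 2, Real.sq_sqrt hn'.le]
  have hmean : ∫ u, (cellInd b k i u - ((b : ℝ) ^ k)⁻¹) ∂unif = 0 := by
    rw [integral_sub ((memLp_cellInd b k i 1).integrable le_rfl) (integrable_const _),
      integral_cellInd hi]
    simp
  have hsq : ∫ u, (cellInd b k i u - ((b : ℝ) ^ k)⁻¹) ^ 2 ∂unif ≤ ((b : ℝ) ^ k)⁻¹ :=
    (integral_cellInd_sub_sq hi).trans_le (sub_le_self _ (sq_nonneg _))
  have hinv : (n : ℝ)⁻¹ ≤ b * ((b : ℝ) ^ k)⁻¹ := by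
    rw [← div_eq_mul_inv, le_div_iff₀ hpos, inv_mul_le_iff₀ hn', mul_comm]
    exact_mod_cast hk
  simp_rw [dev_eq_sum, mul_pow, hsqrt]
  rw [integral_const_mul]
  calc ((n : ℝ) ^ 2)⁻¹ * ∫ x, (∑ j, (cellInd b k i (x j) - ((b : ℝ) ^ k)⁻¹)) ^ 4 ∂dataLaw n
      ≤ ((n : ℝ) ^ 2)⁻¹ * (n * ((b : ℝ) ^ k)⁻¹ + 3 * (n * ((b : ℝ) ^ k)⁻¹) ^ 2) := by
        gcongr
        refine (integral_pi_sum_pow_four_le (memLp_cellInd_sub b k i _ 4) hmean n).trans ?_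
        gcongr
        exact integral_cellInd_sub_pow_four_le hi
    _ = (n : ℝ)⁻¹ * ((b : ℝ) ^ k)⁻¹ + 3 * (((b : ℝ) ^ k)⁻¹) ^ 2 := by field_simp
    _ ≤ (b * ((b : ℝ) ^ k)⁻¹) * ((b : ℝ) ^ k)⁻¹ + 3 * (((b : ℝ) ^ k)⁻¹) ^ 2 := by gcongr
    _ = (b + 3) * (((b : ℝ) ^ k)⁻¹) ^ 2 := by ring

/-- A bound for the normalized deviations of level `k`. -/
def devBound (b k : ℕ) (x : Fin n → ℝ) : ℝ := levelBound b k (dev b k x)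

lemma devBound_nonneg (b k : ℕ) (x : Fin n → ℝ) : 0 ≤ devBound b k x := levelBound_nonneg _ _ _

lemma integrable_devBound (b k n : ℕ) :
    Integrable (fun x : Fin n → ℝ => devBound b k x) (dataLaw n) :=
  integrable_levelBound fun i _ => integrable_dev_pow_four b n k i

lemma integral_devBound_le (hb : 1 < b) (hn : 0 < n) {k : ℕ} (hk : b ^ k ≤ b * n) :
    ∫ x, devBound b k x ∂dataLaw n ≤ (b + 4) * (125 / 128) ^ k := by
  refine (integral_levelBound_le (C := b + 3) hb (by positivity)
    (fun i _ => integrable_dev_pow_four b n k i)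
    fun i hi => integral_dev_pow_four_le hn hi hk).trans_eq ?_
  ring

lemma abs_count_sub_le (hn : 0 < n) (x : Fin n → ℝ) {k i : ℕ} (hi : i < b ^ k) :
    |(count b x k i : ℝ) - n * ((b : ℝ) ^ k)⁻¹| ≤ √n * devBound b k x := by
  have hs : 0 < √(n : ℝ) := Real.sqrt_pos.2 (by exact_mod_cast hn)
  have h := abs_le_levelBound (dev b k x) hi
  rwa [dev, abs_div, abs_of_pos hs, div_le_iff₀' hs] at h

end Moments

section Separation

variable {b n : ℕ}

lemma exists_pair_of_one_lt_count (hb : 0 < b) {x : Fin n → ℝ} {m i : ℕ}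
    (h : 1 < count b x m i) :
    ∃ q ∈ (Finset.univ : Finset (Fin n)).offDiag ×ˢ Finset.range (b ^ m),
      cell b m (x q.1.1) = q.2 ∧ cell b m (x q.1.2) = q.2 := by
  obtain ⟨j, hj, l, hl, hjl⟩ := Finset.one_lt_card.1 h
  rw [mem_cellData] at hj hl
  exact ⟨((j, l), i), by simpa [hjl] using hj ▸ cell_lt hb m (x j), hj, hl⟩

lemma dataLaw_cell_eq_and_cell_eq {m i : ℕ} (hi : i < b ^ m) {j l : Fin n} (hjl : j ≠ l) :
    (dataLaw n).real {x | cell b m (x j) = i ∧ cell b m (x l) = i} = (((b : ℝ) ^ m)⁻¹) ^ 2 := by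
  have hs : MeasurableSet {u | cell b m u = i} := measurable_cell b m (measurableSet_singleton i)
  have hindep : IndepFun (fun x : Fin n → ℝ => x j) (fun x => x l) (dataLaw n) :=
    (iIndepFun_pi (X := fun _ u => u) fun _ => aemeasurable_id).indepFun hjl
  have heval (j : Fin n) :
      (dataLaw n).real ((fun x => x j) ⁻¹' {u | cell b m u = i}) = ((b : ℝ) ^ m)⁻¹ := by
    rw [← unif_cell hi]
    exact (measurePreserving_eval (fun _ : Fin n => unif) j).measureReal_preimage
      hs.nullMeasurableSet
  have hmul := congrArg ENNReal.toReal (hindep.measure_inter_preimage_eq_mul _ _ hs hs)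
  rw [ENNReal.toReal_mul] at hmul
  exact hmul.trans (by rw [← measureReal_def, ← measureReal_def, heval, heval, sq])

lemma dataLaw_exists_one_lt_count_le (hb : 0 < b) (n m : ℕ) :
    (dataLaw n).real {x | ∃ i, 1 < count b x m i} ≤ (n : ℝ) ^ 2 * ((b : ℝ) ^ m)⁻¹ := by
  set s := (Finset.univ : Finset (Fin n)).offDiag ×ˢ Finset.range (b ^ m) with hs
  have hcard : (s.card : ℝ) ≤ (n : ℝ) ^ 2 * (b : ℝ) ^ m := by
    have : s.card ≤ n ^ 2 * b ^ m := by
      rw [hs, Finset.card_product, Finset.card_range, Finset.offDiag_card, Finset.card_univ,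
        Fintype.card_fin, sq]
      gcongr
      exact Nat.sub_le _ _
    exact_mod_cast this
  calc (dataLaw n).real {x | ∃ i, 1 < count b x m i}
      ≤ (dataLaw n).real (⋃ q ∈ s, {x | cell b m (x q.1.1) = q.2 ∧ cell b m (x q.1.2) = q.2}) :=
        measureReal_mono (fun x ⟨i, hi⟩ => by
          simpa only [Set.mem_iUnion₂, exists_prop] using! exists_pair_of_one_lt_count hb hi)
          (measure_ne_top _ _)
    _ ≤ ∑ q ∈ s, (dataLaw n).real {x | cell b m (x q.1.1) = q.2 ∧ cell b m (x q.1.2) = q.2} :=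
        measureReal_biUnion_finset_le _ _
    _ = s.card * (((b : ℝ) ^ m)⁻¹) ^ 2 := by
        rw [Finset.sum_congr rfl fun q hq => ?_, Finset.sum_const, nsmul_eq_mul]
        obtain ⟨hoff, hi⟩ := Finset.mem_product.1 hq
        exact dataLaw_cell_eq_and_cell_eq (Finset.mem_range.1 hi) (Finset.mem_offDiag.1 hoff).2.2
    _ ≤ (n : ℝ) ^ 2 * (b : ℝ) ^ m * (((b : ℝ) ^ m)⁻¹) ^ 2 := by gcongr
    _ = (n : ℝ) ^ 2 * ((b : ℝ) ^ m)⁻¹ := by field_simp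

end Separation

section TimeChange

/-! ### Piecewise linear time changes -/

/-- The projection of the real line onto `[0,1]`. -/
def clamp (u : ℝ) : ℝ := max 0 (min 1 u)

lemma clamp_nonneg (u : ℝ) : 0 ≤ clamp u := le_max_left _ _

lemma clamp_le_one (u : ℝ) : clamp u ≤ 1 := max_le zero_le_one (min_le_left _ _)

lemma clamp_mono : Monotone clamp := fun u v h => by unfold clamp; gcongr

lemma continuous_clamp : Continuous clamp := by unfold clamp; fun_prop

lemma clamp_of_nonpos {u : ℝ} (h : u ≤ 0) : clamp u = 0 := by
  rw [clamp, min_eq_right (h.trans zero_le_one), max_eq_left h]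

lemma clamp_of_one_le {u : ℝ} (h : 1 ≤ u) : clamp u = 1 := by
  rw [clamp, min_eq_left h, max_eq_right zero_le_one]

lemma clamp_of_mem {u : ℝ} (h0 : 0 ≤ u) (h1 : u ≤ 1) : clamp u = u := by
  rw [clamp, min_eq_right h1, max_eq_right h0]

lemma clamp_lt_one {u : ℝ} (h : u < 1) : clamp u < 1 :=
  max_lt zero_lt_one ((min_le_right _ _).trans_lt h)

lemma clamp_lt_clamp {u v : ℝ} (h0 : 0 ≤ u) (h1 : u < 1) (h : u < v) : clamp u < clamp v := by
  rw [clamp_of_mem h0 h1.le]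
  exact lt_max_of_lt_right (lt_min h1 h)

lemma sum_clamp_sub (N : ℕ) {u : ℝ} (hu : 0 ≤ u) :
    ∑ i ∈ Finset.range N, clamp (u - i) = min (N : ℝ) u := by
  induction N with
  | zero => simp [hu]
  | succ N ih =>
    rw [Finset.sum_range_succ, ih, Nat.cast_succ]
    rcases le_total u N with h | h
    · rw [min_eq_right h, clamp_of_nonpos (by linarith), min_eq_right (by linarith), add_zero]
    · rw [min_eq_left h]
      rcases le_total u (N + 1) with h' | h'
      · rw [clamp_of_mem (by linarith) (by linarith), min_eq_right h', add_sub_cancel]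
      · rw [clamp_of_one_le (by linarith), min_eq_left h']

/-- The continuous piecewise linear function that maps the interval `[i / N, (i + 1) / N]` to an
interval of length `p i`, for `i < N`. -/
def timeChange (N : ℕ) (p : ℕ → ℝ) (t : ℝ) : ℝ := ∑ i ∈ Finset.range N, p i * clamp (t * N - i)

variable {N : ℕ} {p : ℕ → ℝ}

lemma continuous_timeChange (N : ℕ) (p : ℕ → ℝ) : Continuous (timeChange N p) :=
  continuous_finsetSum _ fun _ _ => continuous_const.mul (continuous_clamp.comp (by fun_prop))

lemma timeChange_zero (N : ℕ) (p : ℕ → ℝ) : timeChange N p 0 = 0 :=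
  Finset.sum_eq_zero fun i _ => by rw [clamp_of_nonpos (by simp), mul_zero]

lemma sum_le_timeChange (hp : ∀ i < N, 0 ≤ p i) {i : ℕ} (hi : i ≤ N) {t : ℝ} (ht : i ≤ t * N) :
    ∑ j ∈ Finset.range i, p j ≤ timeChange N p t := by
  calc ∑ j ∈ Finset.range i, p j = ∑ j ∈ Finset.range i, p j * clamp (t * N - j) := by
        refine Finset.sum_congr rfl fun j hj => ?_
        have : (j : ℝ) + 1 ≤ i := by exact_mod_cast Finset.mem_range.1 hj
        rw [clamp_of_one_le (by linarith), mul_one]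
    _ ≤ timeChange N p t :=
        Finset.sum_le_sum_of_subset_of_nonneg (Finset.range_mono hi) fun j hj _ =>
          mul_nonneg (hp j (Finset.mem_range.1 hj)) (clamp_nonneg _)

lemma timeChange_lt_sum (hp : ∀ i < N, 0 < p i) {i : ℕ} (hi : i < N) {t : ℝ}
    (ht : t * N < i + 1) : timeChange N p t < ∑ j ∈ Finset.range (i + 1), p j := by
  calc timeChange N p t = ∑ j ∈ Finset.range (i + 1), p j * clamp (t * N - j) := by
        refine (Finset.sum_subset (Finset.range_mono hi) fun j _ hj => ?_).symm
        have : (i : ℝ) + 1 ≤ j := by exact_mod_cast not_lt.1 (Finset.mem_range.not.1 hj)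
        rw [clamp_of_nonpos (by linarith), mul_zero]
    _ < ∑ j ∈ Finset.range (i + 1), p j :=
        Finset.sum_lt_sum
          (fun j hj => mul_le_of_le_one_right
            (hp j ((Finset.mem_range_succ_iff.1 hj).trans_lt hi)).le (clamp_le_one _))
          ⟨i, Finset.self_mem_range_succ i,
            mul_lt_of_lt_one_right (hp i hi) (clamp_lt_one (by linarith))⟩

lemma timeChange_one (N : ℕ) (p : ℕ → ℝ) : timeChange N p 1 = ∑ i ∈ Finset.range N, p i := by
  refine Finset.sum_congr rfl fun i hi => ?_
  have : (i : ℝ) + 1 ≤ N := by exact_mod_cast Finset.mem_range.1 hi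
  rw [clamp_of_one_le (by linarith), mul_one]

lemma strictMonoOn_timeChange (hN : 0 < N) (hp : ∀ i < N, 0 < p i) :
    StrictMonoOn (timeChange N p) I := by
  intro s hs t ht hst
  have hN' : (0 : ℝ) < N := by exact_mod_cast hN
  have h0 : 0 ≤ s * N := mul_nonneg hs.1 hN'.le
  have hmul : s * N < t * N := by gcongr
  have hlt : ⌊s * N⌋₊ < N :=
    (Nat.floor_lt h0).2 (hmul.trans_le (mul_le_of_le_one_left hN'.le ht.2))
  refine Finset.sum_lt_sum
    (fun i hi => mul_le_mul_of_nonneg_left (clamp_mono (by linarith))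
      (hp i (Finset.mem_range.1 hi)).le)
    ⟨⌊s * N⌋₊, Finset.mem_range.2 hlt, mul_lt_mul_of_pos_left (clamp_lt_clamp ?_ ?_ ?_)
      (hp _ hlt)⟩
  · linarith [Nat.floor_le h0]
  · linarith [Nat.lt_floor_add_one (s * N)]
  · linarith

lemma abs_timeChange_sub_le (hN : 0 < N) (p : ℕ → ℝ) {t : ℝ} (ht : t ∈ I) :
    |timeChange N p t - t| ≤ ∑ i ∈ Finset.range N, |p i - (N : ℝ)⁻¹| := by
  have hN' : (0 : ℝ) < N := by exact_mod_cast hN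
  have hid : t = ∑ i ∈ Finset.range N, (N : ℝ)⁻¹ * clamp (t * N - i) := by
    rw [← Finset.mul_sum, sum_clamp_sub N (mul_nonneg ht.1 hN'.le),
      min_eq_right (mul_le_of_le_one_left hN'.le ht.2)]
    field_simp
  calc |timeChange N p t - t|
      = |∑ i ∈ Finset.range N, (p i - (N : ℝ)⁻¹) * clamp (t * N - i)| := by
        simp_rw [sub_mul]
        rw [Finset.sum_sub_distrib, ← hid, timeChange]
    _ ≤ ∑ i ∈ Finset.range N, |(p i - (N : ℝ)⁻¹) * clamp (t * N - i)| :=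
        Finset.abs_sum_le_sum_abs _ _
    _ ≤ ∑ i ∈ Finset.range N, |p i - (N : ℝ)⁻¹| := by
        refine Finset.sum_le_sum fun i _ => ?_
        rw [abs_mul, abs_of_nonneg (clamp_nonneg _)]
        exact mul_le_of_le_one_right (abs_nonneg _) (clamp_le_one _)

lemma image_timeChange (hN : 0 < N) (hp : ∀ i < N, 0 < p i)
    (hsum : ∑ i ∈ Finset.range N, p i = 1) : timeChange N p '' I = I := by
  rw [unitInterval, (continuous_timeChange N p).continuousOn.image_Icc_of_monotoneOn zero_le_one
    (strictMonoOn_timeChange hN hp).monotoneOn, timeChange_zero, timeChange_one, hsum]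

/-- The function `timeChange N p` as an increasing bijection of `[0,1]`. -/
def timeChangeIso (hN : 0 < N) (hp : ∀ i < N, 0 < p i) (hsum : ∑ i ∈ Finset.range N, p i = 1) :
    I ≃o I :=
  ((strictMonoOn_timeChange hN hp).orderIso _ _).trans
    (OrderIso.setCongr _ _ (image_timeChange hN hp hsum))

lemma coe_timeChangeIso (hN : 0 < N) (hp : ∀ i < N, 0 < p i)
    (hsum : ∑ i ∈ Finset.range N, p i = 1) (t : I) :
    (timeChangeIso hN hp hsum t : ℝ) = timeChange N p t := rfl

end TimeChange

section Comparison

/-! ### Comparison with the approximations -/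

variable {b n : ℕ}

lemma below_lt_of_count_pos (hb : 0 < b) {x : Fin n → ℝ} {k i : ℕ} (hi : i < b ^ k)
    (h : 0 < count b x k i) : below b x k i < n := by
  calc below b x k i < below b x k (i + 1) := by
        rw [below_eq_sum, below_eq_sum, Finset.sum_range_succ]
        exact Nat.lt_add_of_pos_right h
    _ ≤ n := (below_mono x k hi).trans_eq (below_pow hb x k)

lemma exists_timeChange_rank (hb : 0 < b) (hn : 0 < n) {K : ℕ} {x : Fin n → ℝ}
    (hpos : ∀ i < b ^ K, 0 < count b x K i) :
    ∃ φ : I ≃o I,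
      (∀ t, |(φ t : ℝ) - t| ≤
        ∑ i ∈ Finset.range (b ^ K), |(count b x K i : ℝ) / n - ((b : ℝ) ^ K)⁻¹|) ∧
      ∀ t : I, below b x K (cell b K t) < min (⌊(φ t : ℝ) * n⌋₊ + 1) n ∧
        min (⌊(φ t : ℝ) * n⌋₊ + 1) n ≤ below b x K (cell b K t + 1) := by
  have hn' : (0 : ℝ) < n := by exact_mod_cast hn
  have hN : 0 < b ^ K := pow_pos hb K
  have hbelow (k : ℕ) : ∑ i ∈ Finset.range k, (count b x K i : ℝ) / n = below b x K k / n := by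
    rw [below_eq_sum, ← Finset.sum_div, Nat.cast_sum]
  have hp (i : ℕ) (hi : i < b ^ K) : 0 < (count b x K i : ℝ) / n :=
    div_pos (by exact_mod_cast hpos i hi) hn'
  have hsum : ∑ i ∈ Finset.range (b ^ K), (count b x K i : ℝ) / n = 1 := by
    rw [hbelow, below_pow hb, div_self hn'.ne']
  refine ⟨timeChangeIso hN hp hsum, fun t => ?_, fun t => ?_⟩ <;> rw [coe_timeChangeIso]
  · exact_mod_cast abs_timeChange_sub_le hN _ t.2
  set f := timeChange (b ^ K) (fun i => (count b x K i : ℝ) / n) t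
  have hcell := cell_lt hb K t
  have htN : 0 ≤ (t : ℝ) * (b : ℝ) ^ K := mul_nonneg t.2.1 (by positivity)
  have hlow : (below b x K (cell b K t) : ℝ) ≤ f * n := by
    rw [← div_le_iff₀ hn', ← hbelow]
    refine sum_le_timeChange (fun i hi => (hp i hi).le) hcell.le ?_
    rw [Nat.cast_pow]
    exact (Nat.cast_le.2 (min_le_left _ _)).trans (Nat.floor_le htN)
  refine ⟨lt_min (Nat.lt_succ_of_le (Nat.le_floor hlow))
    (below_lt_of_count_pos hb hcell (hpos _ hcell)), ?_⟩
  rcases (Nat.add_one_le_iff.2 hcell).eq_or_lt with hlast | hnot_last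
  · rw [hlast, below_pow hb]
    exact min_le_right _ _
  · have hfloor : ⌊(t : ℝ) * (b : ℝ) ^ K⌋₊ < cell b K t + 1 := by
      unfold cell at hnot_last ⊢
      omega
    have hup : f < below b x K (cell b K t + 1) / n := by
      rw [← hbelow]
      refine timeChange_lt_sum hp hcell ?_
      rw [Nat.cast_pow]
      exact_mod_cast (Nat.floor_lt htN).1 hfloor
    have hf0 : 0 ≤ f * n := (Nat.cast_nonneg _).trans hlow
    exact (min_le_left _ _).trans ((Nat.floor_lt hf0).2 ((lt_div_iff₀ hn').1 hup))

lemma splitCost_le (N : ℕ) : splitCost N ≤ N := by unfold splitCost; split_ifs <;> omega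

lemma le_splitCost_add_one (N : ℕ) : N ≤ splitCost N + 1 := by
  unfold splitCost; split_ifs <;> omega

lemma abs_splitCost_sub_le (N : ℕ) : |(splitCost N : ℝ) - N| ≤ 1 := by
  have h1 : (splitCost N : ℝ) ≤ N := by exact_mod_cast splitCost_le N
  have h2 : (N : ℝ) ≤ splitCost N + 1 := by exact_mod_cast le_splitCost_add_one N
  rw [abs_le]
  constructor <;> linarith

lemma abs_sum_splitCost_sub_sum_le {c : ℕ → ℕ} {a d : ℕ → ℝ} {s : Finset ℕ}
    (h : ∀ l ∈ s, |(c l : ℝ) - a l| ≤ d l) :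
    |∑ l ∈ s, (splitCost (c l) : ℝ) - ∑ l ∈ s, a l| ≤ ∑ l ∈ s, d l + s.card := by
  calc |∑ l ∈ s, (splitCost (c l) : ℝ) - ∑ l ∈ s, a l|
      ≤ ∑ l ∈ s, |(splitCost (c l) : ℝ) - a l| := by
        rw [← Finset.sum_sub_distrib]
        exact Finset.abs_sum_le_sum_abs _ _
    _ ≤ ∑ l ∈ s, (d l + 1) := Finset.sum_le_sum fun l hl => by
        linarith [abs_sub_le (splitCost (c l) : ℝ) (c l) (a l), abs_splitCost_sub_le (c l), h l hl]
    _ = ∑ l ∈ s, d l + s.card := by simp [Finset.sum_add_distrib]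

lemma sum_Ico_splitCost_le {c : ℕ → ℕ} (hc : Antitone c) {L m : ℕ} (hLm : L ≤ m) :
    ∑ l ∈ Finset.Ico L m, (splitCost (c l) : ℝ) ≤ (m - L) * c L := by
  calc ∑ l ∈ Finset.Ico L m, (splitCost (c l) : ℝ) ≤ ∑ _l ∈ Finset.Ico L m, (c L : ℝ) := by
        refine Finset.sum_le_sum fun l hl => ?_
        exact_mod_cast (splitCost_le _).trans (hc (Finset.mem_Ico.1 hl).1)
    _ = (m - L) * c L := by
        rw [Finset.sum_const, Nat.card_Ico, nsmul_eq_mul, Nat.cast_sub hLm]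

lemma sum_Ico_inv_pow (hb : 1 < b) {K L : ℕ} (h : K < L) :
    ∑ l ∈ Finset.Ico (K + 1) L, ((b : ℝ) ^ l)⁻¹ =
      (((b : ℝ) ^ K)⁻¹ - b * ((b : ℝ) ^ L)⁻¹) / ((b : ℝ) - 1) := by
  have hb1 : (b : ℝ) - 1 ≠ 0 := sub_ne_zero.2 (by exact_mod_cast hb.ne')
  have hb0 : (b : ℝ) ≠ 0 := by positivity
  induction L, h using Nat.le_induction with
  | base =>
    rw [Finset.Ico_self, Finset.sum_empty, pow_succ]
    field_simp
    ring
  | succ L hL ih =>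
    rw [Finset.sum_Ico_succ_top hL, ih, pow_succ]
    field_simp
    ring

lemma mul_inv_pow_le_one (hb : 0 < b) {L : ℕ} (hnL : n ≤ b ^ L) :
    (n : ℝ) * ((b : ℝ) ^ L)⁻¹ ≤ 1 := by
  rw [← div_eq_mul_inv, div_le_one (by positivity)]
  exact_mod_cast hnL

lemma abs_sum_Ico_mul_inv_pow_sub_le (hb : 1 < b) {K L : ℕ} (hKL : K < L)
    (hnL : n ≤ b ^ L) {c d : ℝ} (hc : |c - n * ((b : ℝ) ^ K)⁻¹| ≤ d) :
    |∑ l ∈ Finset.Ico (K + 1) L, n * ((b : ℝ) ^ l)⁻¹ - c / ((b : ℝ) - 1)| ≤ d + 2 := by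
  have hb2 : (2 : ℝ) ≤ b := by exact_mod_cast hb
  have hb1 : (0 : ℝ) < (b : ℝ) - 1 := by linarith
  have hd : 0 ≤ d := (abs_nonneg _).trans hc
  have hL0 : 0 ≤ (n : ℝ) * ((b : ℝ) ^ L)⁻¹ := by positivity
  have hL1 := mul_inv_pow_le_one hb.pos hnL
  have hdiff : ∑ l ∈ Finset.Ico (K + 1) L, n * ((b : ℝ) ^ l)⁻¹ - c / ((b : ℝ) - 1) =
      (n * ((b : ℝ) ^ K)⁻¹ - c - b * (n * ((b : ℝ) ^ L)⁻¹)) / ((b : ℝ) - 1) := by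
    rw [← Finset.mul_sum, sum_Ico_inv_pow hb hKL]
    ring
  rw [hdiff, abs_div, abs_of_pos hb1, div_le_iff₀ hb1, abs_le]
  rw [abs_le] at hc
  constructor <;> nlinarith

lemma abs_sum_splitCost_sub_le (hb : 1 < b) {c : ℕ → ℕ} (hc : Antitone c) {d : ℕ → ℝ}
    {K L m : ℕ} (hKL : K < L) (hLm : L ≤ m) (hnL : n ≤ b ^ L)
    (hd : ∀ l ≤ L, |(c l : ℝ) - n * ((b : ℝ) ^ l)⁻¹| ≤ d l) :
    |∑ l ∈ Finset.range m, (splitCost (c l) : ℝ) -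
        (∑ l ∈ Finset.range (K + 1), (c l : ℝ) + (c K : ℝ) / ((b : ℝ) - 1))| ≤
      ∑ l ∈ Finset.Ico K L, d l + (m - L) * d L + (m + 2) := by
  have hsplit : ∑ l ∈ Finset.range m, (splitCost (c l) : ℝ) =
      ∑ l ∈ Finset.range (K + 1), (splitCost (c l) : ℝ) +
        ∑ l ∈ Finset.Ico (K + 1) L, (splitCost (c l) : ℝ) +
          ∑ l ∈ Finset.Ico L m, (splitCost (c l) : ℝ) := by
    rw [Finset.sum_range_add_sum_Ico _ hKL, Finset.sum_range_add_sum_Ico _ hLm]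
  have htop : |∑ l ∈ Finset.range (K + 1), (splitCost (c l) : ℝ) -
      ∑ l ∈ Finset.range (K + 1), (c l : ℝ)| ≤ K + 1 := by
    simpa using abs_sum_splitCost_sub_sum_le (c := c) (a := fun l => c l) (d := fun _ => 0)
      (s := Finset.range (K + 1)) fun l _ => by simp
  have hmiddle : |∑ l ∈ Finset.Ico (K + 1) L, (splitCost (c l) : ℝ) -
      ∑ l ∈ Finset.Ico (K + 1) L, n * ((b : ℝ) ^ l)⁻¹| ≤
        ∑ l ∈ Finset.Ico (K + 1) L, d l + (L - (K + 1)) := by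
    have h := abs_sum_splitCost_sub_sum_le fun l hl =>
      hd l (Finset.mem_Ico.1 (hl : l ∈ Finset.Ico (K + 1) L)).2.le
    rwa [Nat.card_Ico, Nat.cast_sub hKL, Nat.cast_succ] at h
  have hmean := abs_sum_Ico_mul_inv_pow_sub_le hb hKL hnL (hd K hKL.le)
  have hbottom0 : 0 ≤ ∑ l ∈ Finset.Ico L m, (splitCost (c l) : ℝ) := by positivity
  have hbottom : ∑ l ∈ Finset.Ico L m, (splitCost (c l) : ℝ) ≤ (m - L) * (d L + 1) := by
    have hcL : (c L : ℝ) ≤ d L + 1 := by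
      linarith [(abs_le.1 (hd L le_rfl)).2, mul_inv_pow_le_one hb.pos hnL]
    exact (sum_Ico_splitCost_le hc hLm).trans
      (mul_le_mul_of_nonneg_left hcL (sub_nonneg.2 (Nat.cast_le.2 hLm)))
  rw [hsplit, Finset.sum_eq_sum_Ico_succ_bot hKL d]
  rw [abs_le] at htop hmiddle hmean ⊢
  constructor <;> linarith

lemma sum_range_mul_sub_inv_mul (hb : 1 < b) (c : ℕ → ℝ) (K : ℕ) :
    ∑ m ∈ Finset.range K, (b : ℝ) / ((b : ℝ) - 1) * (c (m + 1) - (b : ℝ)⁻¹ * c m) =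
      ∑ l ∈ Finset.range (K + 1), c l + c K / ((b : ℝ) - 1) - b / (b - 1) * c 0 := by
  have hb1 : (b : ℝ) - 1 ≠ 0 := sub_ne_zero.2 (by exact_mod_cast hb.ne')
  have hb0 : (b : ℝ) ≠ 0 := by positivity
  induction K with
  | zero =>
    simp only [Finset.range_zero, Finset.sum_empty, zero_add, Finset.range_one,
      Finset.sum_singleton]
    field_simp
    ring
  | succ K ih =>
    rw [Finset.sum_range_succ, ih, Finset.sum_range_succ _ (K + 1)]
    field_simp
    ring

lemma dataApprox_apply (hb : 1 < b) (K : ℕ) (x : Fin n → ℝ) (t : I) :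
    dataApprox hb.pos K x t = (√n)⁻¹ *
      (∑ l ∈ Finset.range (K + 1), (count b x l (cell b l t) : ℝ) +
        (count b x K (cell b K t) : ℝ) / ((b : ℝ) - 1) - b / (b - 1) * n) := by
  have hroot : (count b x 0 (cell b 0 t) : ℝ) = n := by
    simp [count, cellData, cell_zero]
  have hsum := sum_range_mul_sub_inv_mul hb (fun l => (count b x l (cell b l t) : ℝ)) K
  simp only [hroot] at hsum
  rw [dataApprox, pathStep_apply, pathSum, ← Finset.mul_sum, ← hsum]
  congr 1
  refine Finset.sum_congr rfl fun m _ => ?_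
  simp only [dataInnov, count_eq_sum_cellInd, Nat.add_sub_cancel, cell_succ_div hb.pos]
  rw [← Finset.mul_sum, Finset.sum_sub_distrib, Finset.mul_sum]

lemma X_of_rank_eq (hb : 0 < b) {x : Fin n → ℝ} {m : ℕ} (hm : ∀ i, count b x m i ≤ 1) {j : Fin n}
    {t : I} (hj : rank x j = min (⌊(t : ℝ) * n⌋₊ + 1) n) :
    X b x t = (√n)⁻¹ *
      (∑ l ∈ Finset.range m, (splitCost (count b x l (cell b l (x j))) : ℝ) -
        b / (b - 1) * n) := by
  change normalized b x t = _
  rw [normalized, ← hj, Y_rank hb x j hm, ENat.toNat_natCast, Nat.cast_sum, div_eq_inv_mul]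

/-- A bound for the error of the approximation by the first `K` levels: the occupation numbers of
the levels below `L` are compared with their means, those of the levels from `L` to `3 * L` with the
ones of level `L`. -/
def errorBound (b K L : ℕ) (x : Fin n → ℝ) : ℝ :=
  ∑ l ∈ Finset.Ico K L, devBound b l x + 2 * L * devBound b L x + (3 * L + 2) / √n +
    (b : ℝ) ^ K * devBound b K x / √n

lemma pow_mul_devBound_div_le_errorBound (b K L : ℕ) (x : Fin n → ℝ) :
    (b : ℝ) ^ K * devBound b K x / √n ≤ errorBound b K L x := by
  have hsum := Finset.sum_nonneg fun l (_ : l ∈ Finset.Ico K L) => devBound_nonneg b l x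
  have hL := devBound_nonneg b L x
  exact le_add_of_nonneg_left (by positivity)

lemma count_pos_of_devBound_lt (hn : 0 < n) {K : ℕ} {x : Fin n → ℝ}
    (h : (b : ℝ) ^ K * devBound b K x / √n < 1) {i : ℕ} (hi : i < b ^ K) : 0 < count b x K i := by
  have hpow : (0 : ℝ) < (b : ℝ) ^ K := by exact_mod_cast (Nat.zero_le i).trans_lt hi
  have hs : 0 < √(n : ℝ) := Real.sqrt_pos.2 (by exact_mod_cast hn)
  have hlt : √n * devBound b K x < n * ((b : ℝ) ^ K)⁻¹ := by
    rw [div_lt_one hs] at h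
    rw [← div_eq_mul_inv, lt_div_iff₀ hpow]
    calc √n * devBound b K x * (b : ℝ) ^ K = √n * ((b : ℝ) ^ K * devBound b K x) := by ring
      _ < √n * √n := by gcongr
      _ = n := Real.mul_self_sqrt (Nat.cast_nonneg n)
  have hcount : (0 : ℝ) < count b x K i := by
    linarith [(abs_le.1 (abs_count_sub_le hn x hi)).1]
  exact_mod_cast hcount

lemma sum_abs_count_div_sub_le (hn : 0 < n) (b K : ℕ) (x : Fin n → ℝ) :
    ∑ i ∈ Finset.range (b ^ K), |(count b x K i : ℝ) / n - ((b : ℝ) ^ K)⁻¹| ≤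
      (b : ℝ) ^ K * devBound b K x / √n := by
  have hn' : (0 : ℝ) < n := by exact_mod_cast hn
  have hterm (i : ℕ) (hi : i ∈ Finset.range (b ^ K)) :
      |(count b x K i : ℝ) / n - ((b : ℝ) ^ K)⁻¹| ≤ devBound b K x / √n := by
    calc |(count b x K i : ℝ) / n - ((b : ℝ) ^ K)⁻¹|
        = |(count b x K i : ℝ) - n * ((b : ℝ) ^ K)⁻¹| / n := by
          rw [← abs_of_pos hn', ← abs_div, abs_of_pos hn', sub_div, mul_div_cancel_left₀ _ hn'.ne']
      _ ≤ √n * devBound b K x / n := by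
          gcongr
          exact abs_count_sub_le hn x (Finset.mem_range.1 hi)
      _ = devBound b K x / √n := by
          rw [mul_comm, mul_div_assoc, Real.sqrt_div_self', mul_one_div]
  calc ∑ i ∈ Finset.range (b ^ K), |(count b x K i : ℝ) / n - ((b : ℝ) ^ K)⁻¹|
      ≤ ∑ _i ∈ Finset.range (b ^ K), devBound b K x / √n := Finset.sum_le_sum hterm
    _ = (b : ℝ) ^ K * devBound b K x / √n := by
        rw [Finset.sum_const, Finset.card_range, nsmul_eq_mul, Nat.cast_pow, mul_div_assoc]

lemma abs_sum_splitCost_count_sub_le (hb : 1 < b) (hn : 0 < n) {K L : ℕ} (hKL : K < L)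
    (hnL : n ≤ b ^ L) (x : Fin n → ℝ) (u : ℝ) :
    |∑ l ∈ Finset.range (3 * L), (splitCost (count b x l (cell b l u)) : ℝ) -
        (∑ l ∈ Finset.range (K + 1), (count b x l (cell b l u) : ℝ) +
          (count b x K (cell b K u) : ℝ) / ((b : ℝ) - 1))| ≤ √n * errorBound b K L x := by
  have hs : 0 < √(n : ℝ) := Real.sqrt_pos.2 (by exact_mod_cast hn)
  refine (abs_sum_splitCost_sub_le hb (antitone_count_cell hb.pos x u)
    (d := fun l => √n * devBound b l x) hKL (Nat.le_mul_of_pos_left L three_pos) hnL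
    fun l _ => abs_count_sub_le hn x (cell_lt hb.pos l u)).trans ?_
  calc ∑ l ∈ Finset.Ico K L, √n * devBound b l x + ((3 * L : ℕ) - L) * (√n * devBound b L x) +
        ((3 * L : ℕ) + 2)
      = √n * (∑ l ∈ Finset.Ico K L, devBound b l x + 2 * L * devBound b L x +
          (3 * L + 2) / √n) := by
        rw [← Finset.mul_sum]
        push_cast
        field_simp
        ring
    _ ≤ √n * errorBound b K L x := by
        gcongr
        exact le_add_of_nonneg_right (div_nonneg (mul_nonneg (by positivity)
          (devBound_nonneg b K x)) hs.le)

lemma dist_X_dataApprox_le (hb : 1 < b) (hn : 0 < n) {K L : ℕ} (hKL : K < L) (hnL : n ≤ b ^ L)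
    {x : Fin n → ℝ} (hcount : ∀ i, count b x (3 * L) i ≤ 1) (herr : errorBound b K L x < 1) :
    dist (X b x) (dataApprox hb.pos K x) ≤ errorBound b K L x := by
  have hs : 0 < √(n : ℝ) := Real.sqrt_pos.2 (by exact_mod_cast hn)
  have hdev := pow_mul_devBound_div_le_errorBound b K L x
  obtain ⟨φ, hφ, hrank⟩ := exists_timeChange_rank hb.pos hn fun i hi =>
    count_pos_of_devBound_lt hn (hdev.trans_lt herr) hi
  rw [dist_comm]
  refine SkorokhodClose.dist_le ⟨φ, fun t =>
    ⟨((hφ t).trans (sum_abs_count_div_sub_le hn b K x)).trans hdev, ?_⟩⟩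
  obtain ⟨j, hj⟩ : ∃ j, rank x j = min (⌊(φ t : ℝ) * n⌋₊ + 1) n :=
    exists_rank_eq (injective_of_count_le_one hcount) (le_min (Nat.le_add_left 1 _) hn)
      (min_le_right _ _)
  have hcell : cell b K (x j) = cell b K t := cell_eq_iff_rank.2 (hj ▸ hrank t)
  have happrox : dataApprox hb.pos K x t = (√n)⁻¹ *
      (∑ l ∈ Finset.range (K + 1), (count b x l (cell b l (x j)) : ℝ) +
        (count b x K (cell b K (x j)) : ℝ) / ((b : ℝ) - 1) - b / (b - 1) * n) := by
    rw [dataApprox_apply hb, hcell]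
    congr 3
    refine Finset.sum_congr rfl fun l hl => ?_
    rw [cell_eq_of_le hb.pos (Finset.mem_range_succ_iff.1 hl) hcell]
  rw [X_of_rank_eq hb.pos hcount hj, happrox, ← mul_sub, abs_mul, abs_of_pos (inv_pos.2 hs),
    sub_sub_sub_cancel_right, abs_sub_comm, inv_mul_le_iff₀ hs]
  exact abs_sum_splitCost_count_sub_le hb hn hKL hnL x (x j)

end Comparison

section ExpectedError

/-! ### The expected error of the approximation -/

variable {n b : ℕ}

lemma tendsto_clog_atTop (hb : 1 < b) : Tendsto (fun n => Nat.clog b n) atTop atTop :=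
  tendsto_atTop.2 fun M => (eventually_gt_atTop (b ^ M)).mono fun _ hn =>
    ((Nat.lt_clog_iff_pow_lt hb).2 hn).le

lemma pow_clog_le (hb : 0 < b) (hn : 0 < n) : b ^ Nat.clog b n ≤ b * n := by
  rcases hL : Nat.clog b n with _ | L
  · rw [pow_zero]
    exact Nat.mul_pos hb hn
  · rw [pow_succ']
    exact Nat.mul_le_mul_left _ (Nat.pow_lt_of_lt_clog (hL ▸ L.lt_succ_self)).le

lemma inv_sqrt_le (hb : 0 < b) (hn : 0 < n) :
    (√(n : ℝ))⁻¹ ≤ √(b : ℝ) * (√(b : ℝ))⁻¹ ^ Nat.clog b n := by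
  have hsn : 0 < √(n : ℝ) := Real.sqrt_pos.2 (by exact_mod_cast hn)
  have : 0 < √(b : ℝ) := Real.sqrt_pos.2 (by exact_mod_cast hb)
  have h : √(b : ℝ) ^ Nat.clog b n ≤ √(b : ℝ) * √n := by
    rw [← Real.sqrt_mul (Nat.cast_nonneg b), Real.le_sqrt (by positivity) (by positivity),
      pow_right_comm, Real.sq_sqrt (Nat.cast_nonneg b)]
    exact_mod_cast pow_clog_le hb hn
  rwa [inv_pow, ← div_eq_mul_inv, le_div_iff₀ (by positivity), inv_mul_le_iff₀ hsn,
    mul_comm √(n : ℝ)]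

lemma errorBound_nonneg (b K L : ℕ) (x : Fin n → ℝ) : 0 ≤ errorBound b K L x :=
  (div_nonneg (mul_nonneg (by positivity) (devBound_nonneg b K x)) (Real.sqrt_nonneg _)).trans
    (pow_mul_devBound_div_le_errorBound b K L x)

lemma integrable_errorBound (b K L n : ℕ) :
    Integrable (fun x : Fin n → ℝ => errorBound b K L x) (dataLaw n) :=
  (((integrable_finsetSum _ fun l _ => integrable_devBound b l n).add
    ((integrable_devBound b L n).const_mul _)).add (integrable_const _)).add
    (((integrable_devBound b K n).const_mul _).div_const _)

lemma integral_errorBound (b K L n : ℕ) :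
    ∫ x, errorBound b K L x ∂dataLaw n =
      ∑ l ∈ Finset.Ico K L, ∫ x, devBound b l x ∂dataLaw n +
        2 * L * ∫ x, devBound b L x ∂dataLaw n + (3 * L + 2) / √n +
        (b : ℝ) ^ K * (∫ x, devBound b K x ∂dataLaw n) / √n := by
  have i1 : Integrable (fun x : Fin n → ℝ => ∑ l ∈ Finset.Ico K L, devBound b l x) (dataLaw n) :=
    integrable_finsetSum _ fun l _ => integrable_devBound b l n
  have i2 : Integrable (fun x : Fin n → ℝ => 2 * L * devBound b L x) (dataLaw n) :=
    (integrable_devBound b L n).const_mul _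
  have i12 : Integrable (fun x : Fin n → ℝ => ∑ l ∈ Finset.Ico K L, devBound b l x +
      2 * L * devBound b L x) (dataLaw n) := i1.add i2
  have i123 : Integrable (fun x : Fin n → ℝ => ∑ l ∈ Finset.Ico K L, devBound b l x +
      2 * L * devBound b L x + (3 * L + 2) / √n) (dataLaw n) := i12.add (integrable_const _)
  unfold errorBound
  rw [integral_add i123 (((integrable_devBound b K n).const_mul _).div_const _),
    integral_add i12 (integrable_const _), integral_add i1 i2,
    integral_finsetSum _ fun l _ => integrable_devBound b l n, integral_const_mul, integral_const,
    probReal_univ, one_smul, integral_div, integral_const_mul]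

/-- The part of the bound for the expected error that vanishes as `L → ∞`. -/
def remainder (b K L : ℕ) : ℝ :=
  (b + 4) * (2 * (L * (125 / 128 : ℝ) ^ L)) +
    (3 * L + 2 + (b : ℝ) ^ K * (b + 4)) * (√(b : ℝ) * (√(b : ℝ))⁻¹ ^ L)

lemma tendsto_remainder (hb : 1 < b) (K : ℕ) : Tendsto (remainder b K) atTop (𝓝 0) := by
  have hq : (√(b : ℝ))⁻¹ < 1 :=
    inv_lt_one_of_one_lt₀ (Real.lt_sqrt_of_sq_lt (by rw [one_pow]; exact_mod_cast hb))
  have hq0 : 0 ≤ (√(b : ℝ))⁻¹ := by positivity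
  have h1 := tendsto_self_mul_const_pow_of_lt_one (r := (125 / 128 : ℝ)) (by norm_num)
    (by norm_num)
  have h2 := tendsto_self_mul_const_pow_of_lt_one hq0 hq
  have h3 := tendsto_pow_atTop_nhds_zero_of_lt_one hq0 hq
  have h := ((h1.const_mul 2).const_mul ((b : ℝ) + 4)).add
    ((h2.const_mul (3 * √(b : ℝ))).add (h3.const_mul ((2 + (b : ℝ) ^ K * (b + 4)) * √(b : ℝ))))
  simp only [mul_zero, add_zero] at h
  refine h.congr fun L => ?_
  unfold remainder
  ring

lemma integral_errorBound_le (hb : 1 < b) (hn : 0 < n) {K : ℕ} (hK : K ≤ Nat.clog b n) :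
    ∫ x, errorBound b K (Nat.clog b n) x ∂dataLaw n ≤
      (b + 4) * 128 / 3 * (125 / 128 : ℝ) ^ K + remainder b K (Nat.clog b n) := by
  set L := Nat.clog b n
  have hdev (l : ℕ) (hl : l ≤ L) :
      ∫ x, devBound b l x ∂dataLaw n ≤ (b + 4) * (125 / 128 : ℝ) ^ l :=
    integral_devBound_le hb hn ((Nat.pow_le_pow_right hb.pos hl).trans (pow_clog_le hb.pos hn))
  have hsum : ∑ l ∈ Finset.Ico K L, ∫ x, devBound b l x ∂dataLaw n ≤
      (b + 4) * 128 / 3 * (125 / 128 : ℝ) ^ K := by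
    calc ∑ l ∈ Finset.Ico K L, ∫ x, devBound b l x ∂dataLaw n
        ≤ ∑ l ∈ Finset.Ico K L, ((b : ℝ) + 4) * (125 / 128 : ℝ) ^ l :=
          Finset.sum_le_sum fun l hl => hdev l (Finset.mem_Ico.1 hl).2.le
      _ ≤ ((b : ℝ) + 4) * ((125 / 128 : ℝ) ^ K / (1 - 125 / 128)) := by
          rw [← Finset.mul_sum]
          gcongr
          exact geom_sum_Ico_le_of_lt_one (by norm_num) (by norm_num)
      _ = (b + 4) * 128 / 3 * (125 / 128 : ℝ) ^ K := by ring
  have hlast : 2 * L * ∫ x, devBound b L x ∂dataLaw n ≤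
      (b + 4) * (2 * (L * (125 / 128 : ℝ) ^ L)) := by
    calc 2 * L * ∫ x, devBound b L x ∂dataLaw n ≤ 2 * L * ((b + 4) * (125 / 128 : ℝ) ^ L) := by
          gcongr
          exact hdev L le_rfl
      _ = (b + 4) * (2 * (L * (125 / 128 : ℝ) ^ L)) := by ring
  have hK1 : ∫ x, devBound b K x ∂dataLaw n ≤ b + 4 :=
    (hdev K hK).trans (mul_le_of_le_one_right (by positivity)
      (pow_le_one₀ (by norm_num) (by norm_num)))
  have hsmall : (3 * L + 2) / √n + (b : ℝ) ^ K * (∫ x, devBound b K x ∂dataLaw n) / √n ≤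
      (3 * L + 2 + (b : ℝ) ^ K * (b + 4)) * (√(b : ℝ) * (√(b : ℝ))⁻¹ ^ L) := by
    rw [← add_div, div_eq_mul_inv]
    gcongr
    exact inv_sqrt_le hb.pos hn
  rw [integral_errorBound, remainder]
  linarith

lemma eventually_integral_errorBound_le (hb : 1 < b) {δ : ℝ} (hδ : 0 < δ) :
    ∀ᶠ K in atTop, ∀ᶠ n in atTop, ∫ x, errorBound b K (Nat.clog b n) x ∂dataLaw n ≤ δ := by
  have hgeom : Tendsto (fun K : ℕ => ((b : ℝ) + 4) * 128 / 3 * (125 / 128 : ℝ) ^ K) atTop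
      (𝓝 0) := by
    simpa using (tendsto_pow_atTop_nhds_zero_of_lt_one (r := (125 / 128 : ℝ)) (by norm_num)
      (by norm_num)).const_mul (((b : ℝ) + 4) * 128 / 3)
  filter_upwards [hgeom.eventually_lt_const (half_pos hδ)] with K hK
  filter_upwards [eventually_gt_atTop 0, (tendsto_clog_atTop hb).eventually_ge_atTop K,
    ((tendsto_remainder hb K).comp (tendsto_clog_atTop hb)).eventually_lt_const (half_pos hδ)]
    with n hn hKL hrem
  rw [Function.comp_apply] at hrem
  linarith [integral_errorBound_le hb hn hKL]

lemma dataLaw_exists_one_lt_count_clog_le (hb : 1 < b) (hn : 0 < n) :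
    (dataLaw n).real {x | ∃ i, 1 < count b x (3 * Nat.clog b n) i} ≤ (n : ℝ)⁻¹ := by
  have : (0 : ℝ) < n := by exact_mod_cast hn
  have hpow : (n : ℝ) ≤ (b : ℝ) ^ Nat.clog b n := by exact_mod_cast Nat.le_pow_clog hb n
  calc (dataLaw n).real {x | ∃ i, 1 < count b x (3 * Nat.clog b n) i}
      ≤ (n : ℝ) ^ 2 * ((b : ℝ) ^ (3 * Nat.clog b n))⁻¹ := dataLaw_exists_one_lt_count_le hb.pos n _
    _ ≤ (n : ℝ) ^ 2 * ((n : ℝ) ^ 3)⁻¹ := by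
        rw [mul_comm 3, pow_mul]
        gcongr
    _ = (n : ℝ)⁻¹ := by field_simp

lemma measureReal_dist_X_dataApprox_le (hb : 1 < b) (hn : 0 < n) {K : ℕ} (hK : K < Nat.clog b n)
    {ε δ : ℝ} (hδ : 0 < δ) (hδε : δ ≤ ε) (hδ1 : δ ≤ 1) :
    (dataLaw n).real {x | ε < dist (X b x) (dataApprox hb.pos K x)} ≤
      (∫ x, errorBound b K (Nat.clog b n) x ∂dataLaw n) / δ + (n : ℝ)⁻¹ := by
  set L := Nat.clog b n
  have hmarkov : (dataLaw n).real {x | δ ≤ errorBound b K L x} ≤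
      (∫ x, errorBound b K L x ∂dataLaw n) / δ := by
    rw [le_div_iff₀' hδ]
    exact mul_meas_ge_le_integral_of_nonneg (.of_forall fun x => errorBound_nonneg b K L x)
      (integrable_errorBound b K L n) δ
  have hsub : {x : Fin n → ℝ | ε < dist (X b x) (dataApprox hb.pos K x)} ⊆
      {x | δ ≤ errorBound b K L x} ∪ {x | ∃ i, 1 < count b x (3 * L) i} := by
    intro x hx
    by_contra! h
    simp only [Set.mem_union, Set.mem_ofPred_eq, not_or, not_le, not_exists, not_lt] at h hx
    exact (hx.trans_le (dist_X_dataApprox_le hb hn hK (Nat.le_pow_clog hb n) h.2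
      (h.1.trans_le hδ1))).not_ge (h.1.le.trans hδε)
  calc (dataLaw n).real {x | ε < dist (X b x) (dataApprox hb.pos K x)}
      ≤ (dataLaw n).real {x | δ ≤ errorBound b K L x} +
          (dataLaw n).real {x | ∃ i, 1 < count b x (3 * L) i} :=
        (measureReal_mono hsub (measure_ne_top _ _)).trans (measureReal_union_le _ _)
    _ ≤ (∫ x, errorBound b K L x ∂dataLaw n) / δ + (n : ℝ)⁻¹ :=
        add_le_add hmarkov (dataLaw_exists_one_lt_count_clog_le hb hn)

lemma eventually_measureReal_dist_X_dataApprox_le (hb : 1 < b) {ε : ℝ} (hε : 0 < ε) :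
    ∀ᶠ K in atTop, ∀ᶠ n in atTop,
      (dataLaw n).real {x | ε < dist (X b x) (dataApprox hb.pos K x)} ≤ ε := by
  set δ := min ε 1
  have hδ0 : 0 < δ := lt_min hε one_pos
  filter_upwards [eventually_integral_errorBound_le hb (show 0 < ε / 2 * δ by positivity)]
    with K hK
  filter_upwards [hK, eventually_gt_atTop 0, (tendsto_clog_atTop hb).eventually_gt_atTop K,
    (tendsto_inv_atTop_nhds_zero_nat (𝕜 := ℝ)).eventually_lt_const (half_pos hε)]
    with n herr hn hKL hinv
  have h := measureReal_dist_X_dataApprox_le hb hn hKL hδ0 (min_le_left ε 1) (min_le_right ε 1)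
  linarith [(div_le_iff₀ hδ0).2 herr]

end ExpectedError

section Convergence

/-! ### Convergence of the processes -/

variable {n b : ℕ}

theorem tendstoInDistribution_X_dataLaw (hb : 1 < b) :
    TendstoInDistribution (fun n (x : Fin n → ℝ) => X b x) atTop (limitPath hb.pos) dataLaw
      noise := by
  refine tendstoInDistribution_of_forall_approx (fun n => (measurable_X b n).aemeasurable)
    (aemeasurable_limitPath hb) (tendstoInDistribution_dataApprox hb.pos) fun ε hε => ?_
  exact ((eventually_measureReal_dist_X_dataApprox_le hb hε).and
    (eventually_measureReal_dist_limitApprox_le hb hε)).exists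

lemma cond_Icc_eq_unif : cond volume (Set.Icc (0 : ℝ) 1) = unif := by
  simp [ProbabilityTheory.cond, unif]

variable {Ω : Type*} [MeasurableSpace Ω] {P : Measure Ω}

lemma aemeasurable_of_isUniform {U : Fin n → Ω → ℝ}
    (hU : ∀ i, pdf.IsUniform (U i) (Set.Icc 0 1) P volume) :
    AEMeasurable (fun ω i => U i ω) P :=
  aemeasurable_pi_iff.2 fun i => (hU i).aemeasurable (by simp) (by simp)

lemma map_eq_dataLaw [IsProbabilityMeasure P] {U : Fin n → Ω → ℝ} (hind : iIndepFun U P)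
    (hU : ∀ i, pdf.IsUniform (U i) (Set.Icc 0 1) P volume) :
    P.map (fun ω i => U i ω) = dataLaw n := by
  rw [(iIndepFun_iff_map_fun_eq_pi_map
    (aemeasurable_pi_iff.1 (aemeasurable_of_isUniform hU))).1 hind]
  congr with i : 1
  exact (hU i).trans cond_Icc_eq_unif

theorem tendstoInDistribution_X (hb : 1 < b) {Ω : ℕ → Type*} [∀ n, MeasurableSpace (Ω n)]
    {P : ∀ n, Measure (Ω n)} [∀ n, IsProbabilityMeasure (P n)] {U : ∀ n, Fin n → Ω n → ℝ}
    (hind : ∀ n, iIndepFun (U n) (P n))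
    (hU : ∀ n i, pdf.IsUniform (U n i) (Set.Icc 0 1) (P n) volume) :
    TendstoInDistribution (fun n ω => X b (fun i => U n i ω)) atTop (limitPath hb.pos) P noise := by
  have hmeas (n : ℕ) := aemeasurable_of_isUniform (hU n)
  refine ⟨fun n => (measurable_X b n).comp_aemeasurable (hmeas n), aemeasurable_limitPath hb, ?_⟩
  refine (tendstoInDistribution_X_dataLaw hb).tendsto.congr fun n => Subtype.ext ?_
  change (dataLaw n).map (X b) = (P n).map (X b ∘ fun ω i => U n i ω)
  rw [← map_eq_dataLaw (hind n) (hU n),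
    AEMeasurable.map_map_of_aemeasurable (measurable_X b n).aemeasurable (hmeas n)]

end Convergence

end RadixSelection

end

theorem theorem2p1 (b : ℕ) (hb : 2 ≤ b) :
    ∃ (Ω' : Type) (_ : MeasurableSpace Ω') (P' : Measure Ω') (_ : IsProbabilityMeasure P')
      (G : Ω' → RadixSelection.Cadlag),
      IsGaussianProcess (fun (t : I) (ω : Ω') => G ω t) P' ∧
      (∀ t : I, ∫ ω, G ω t ∂P' = 0) ∧
      (∀ s t : I, ∫ ω, G ω s * G ω t ∂P' =
        (b : ℝ) / ((b : ℝ) - 1) ^ 2 -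
          ((b : ℝ) + 1) / ((b : ℝ) - 1) ^ 2 *
            RadixSelection.negPow b (RadixSelection.prefixLength b s t)) ∧
      ∀ (Ω : ℕ → Type*) (_ : ∀ n, MeasurableSpace (Ω n)) (P : ∀ n, Measure (Ω n))
        (_ : ∀ n, IsProbabilityMeasure (P n)) (U : ∀ n, Fin n → Ω n → ℝ),
        (∀ n, iIndepFun (U n) (P n)) →
        (∀ n i, pdf.IsUniform (U n i) (Set.Icc 0 1) (P n) volume) →
        TendstoInDistribution
          (fun n ω => RadixSelection.X b (fun i => U n i ω)) atTop G P P' :=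
  ⟨ℕ × ℕ → ℝ, inferInstance, RadixSelection.noise, inferInstance,
    RadixSelection.limitPath (Nat.zero_lt_of_lt hb), RadixSelection.isGaussianProcess_limitPath hb,
    RadixSelection.integral_limitPath hb, RadixSelection.integral_limitPath_mul_limitPath hb,
    fun _ _ _ _ _ hind hU => RadixSelection.tendstoInDistribution_X hb hind hU⟩
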